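/- Let $s\ge -\tfrac12$ and $k\ge 1$, let $\mathbb R^{+}=[0,\infty)$, and let $\mathcal P(E)$ denote the set of Borel probability measures on $E$ with the topology of weak convergence. Notation. Let $\Lambda_s(x)=\Gamma(s+1)J_s(x)/(x/2)^s$ for $x>0$ and $\Lambda_s(0)=1$, where $J_s$ is the Bessel function of the first kind. Let $F_s$ be the symmetric probability measure on $[-1,1]$ with density $\frac{\Gamma(s+1)}{\sqrt\pi\,\Gamma(s+1/2)}(1-u^2)^{s-1/2}$ if $s>-\tfrac12$, and $F_{-1/2}=\tfrac12(\delta_1+\delta_{-1})$. For $x,y\in\mathbb R^+$ let $\delta_x\circ_s\delta_y$ be the law of $(x^2+2\theta xy+y^2)^{1/2}$, where $\theta$ has law $F_s$. For $\mathbf x,\mathbf y\in(\mathbb R^{+})^k$ put $\delta_{\mathbf x}\bigcirc_{s,k}\delta_{\mathbf y}=(\delta_{x_1}\circ_s\delta_{y_1})\times\cdots\times(\delta_{x_k}\circ_s\delta_{y_k})$, and for $\mathbf G_1,\mathbf G_2\in\mathcal P((\mathbb R^{+})^k)$ put $\mathbf G_1\bigcirc_{s,k}\mathbf G_2=\iint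 \delta_{\mathbf x}\bigcirc_{s,k}\delta_{\mathbf y}\,\mathbf G_1(d\mathbf x)\,\mathbf G_2(d\mathbf y)$. The radial characteristic function of $\mathbf G$ is $\hat{\mathbf G}(\mathbf t)=\int\prod_{j=1}^k\Lambda_s(t_jx_j)\,\mathbf G(d\mathbf x)$, $\mathbf t\in(\mathbb R^{+})^k$. Write $T_c$ for the map taking the law of $X$ to the law of $cX$, and define $F_{s,k}:\mathcal P((\mathbb R^{+})^k)\to\mathcal P(\mathbb R^k)$ by $$F_{s,k}(\mathbf G)=\int (T_{c_1}F_s)\times\cdots\times(T_{c_k}F_s)\,\mathbf G(d\mathbf c).$$ Let $\sigma_s$ be the law on $(0,\infty)$ with density $\frac{2(s+1)^{s+1}}{\Gamma(s+1)}y^{2s+1}e^{-(s+1)y^2}$ and let $\Sigma_{s,k}=\sigma_s\times\cdots\times\sigma_s$ ($k$ factors) be the Rayleigh law. Theorem. The measure $F_s$ has characteristic function $t\mapsto\Lambda_s(t)$ for $t\ge 0$, and the following hold. 1. The image of $F_{s,k}$ is closed in $\mathcal P(\mathbb R^k)$ in the weak topology and is closed under ordinary convolution $*$. 2. For every $\mathbf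 G\in\mathcal P((\mathbb R^{+})^k)$ and $\mathbf t\in(\mathbb R^{+})^k$, $\hat{\mathbf G}(\mathbf t)$ equals the characteristic function of $F_{s,k}(\mathbf G)$ at $\mathbf t$. 3. For all $\mathbf G_1,\mathbf G_2\in\mathcal P((\mathbb R^{+})^k)$, $F_{s,k}(\mathbf G_1\bigcirc_{s,k}\mathbf G_2)=F_{s,k}(\mathbf G_1)*F_{s,k}(\mathbf G_2)$, and $F_{s,k}(\delta_{\mathbf 0})=\delta_{\mathbf 0}$. 4. $F_{s,k}$ commutes with (finite) convex combinations of probability measures and with the scale changes $T_c$, $c>0$. 5. $F_{s,k}(\Sigma_{s,k})=N\bigl(\mathbf 0,\tfrac1{2(s+1)}\mathbf I\bigr)$, the centered normal law on $\mathbb R^k$ with covariance matrix $\tfrac1{2(s+1)}\mathbf I$. 6. $F_{s,k}$ is a homeomorphism of $\mathcal P((\mathbb R^{+})^k)$ onto its image. Thus it embeds the $k$-dimensional Kingman convolution algebra $(\mathcal P((\mathbb R^{+})^k),\bigcirc_{s,k})$ into the ordinary convolution algebra $(\mathcal P(\mathbb R^k),*)$. -/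

import Mathlib

open MeasureTheory ProbabilityTheory Topology
open scoped NNReal ENNReal

namespace Kingman

noncomputable section

/-! ### The Bessel kernel and the law `F_s` -/

/-- The Bessel function of the first kind `J_s(x) = ∑ₙ (-1)ⁿ (x/2)^(s+2n) / (n! Γ(s+n+1))`,
used for `x > 0`. -/
def besselJ (s x : ℝ) : ℝ :=
  ∑' n : ℕ, (-1) ^ n * (x / 2) ^ (s + 2 * n) / (n.factorial * Real.Gamma (s + n + 1))

/-- The kernel `Λ_s(x) = Γ(s+1) J_s(x) / (x/2)^s`, `x ≥ 0`, with its limiting value `Λ_s(0) = 1`. -/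
def kernel (s x : ℝ) : ℝ :=
  if x = 0 then 1 else Real.Gamma (s + 1) * besselJ s x / (x / 2) ^ s

/-- The density `Γ(s+1) / (√π Γ(s+1/2)) (1 - u²)^(s-1/2)` on `(-1, 1)`. -/
def thetaDensity (s u : ℝ) : ℝ :=
  if -1 < u ∧ u < 1 then
    Real.Gamma (s + 1) / (√Real.pi * Real.Gamma (s + 1 / 2)) * (1 - u ^ 2) ^ (s - 1 / 2)
  else 0

/-- The measure with density `thetaDensity s`; for `s = -1/2` it is the limiting law
`(δ₁ + δ₋₁) / 2`. -/
def thetaMeasure (s : ℝ) : Measure ℝ :=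
  if s = -(1 / 2) then (2⁻¹ : ℝ≥0∞) • (Measure.dirac 1 + Measure.dirac (-1))
  else volume.withDensity (fun u => ENNReal.ofReal (thetaDensity s u))

lemma lintegral_affine (g : ℝ → ℝ≥0∞) (hg : Measurable g) :
    ∫⁻ u, g u = ∫⁻ x, 2 * g (2 * x - 1) := by
  rw [← lintegral_sub_right_eq_self g (1 : ℝ)]
  conv_lhs => rw [← Real.smul_map_volume_mul_left (two_ne_zero : (2 : ℝ) ≠ 0)]
  rw [lintegral_smul_measure, lintegral_map (by fun_prop) (by fun_prop),
    lintegral_const_mul _ (by fun_prop)]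
  simp

lemma thetaDensity_affine {s : ℝ} (hs : -(1 / 2) < s) (x : ℝ) :
    2 * thetaDensity s (2 * x - 1) = betaPDFReal (s + 1 / 2) (s + 1 / 2) x := by
  unfold thetaDensity betaPDFReal
  by_cases h : 0 < x ∧ x < 1
  · rw [if_pos ⟨by linarith [h.1], by linarith [h.2]⟩, if_pos h]
    obtain ⟨h0, h1⟩ := h
    have ha : 0 < s + 1 / 2 := by linarith
    have e1 : 1 - (2 * x - 1) ^ 2 = 4 * (x * (1 - x)) := by ring
    have dup := Real.Gamma_mul_Gamma_add_half (s + 1 / 2)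
    have e2 : s + 1 / 2 + 1 / 2 = s + 1 := by ring
    rw [e2] at dup
    have hG := Real.Gamma_pos_of_pos ha
    have hG1 : 0 < Real.Gamma (s + 1) := Real.Gamma_pos_of_pos (by linarith)
    have hG2 : 0 < Real.Gamma (2 * (s + 1 / 2)) := Real.Gamma_pos_of_pos (by linarith)
    have hpi : 0 < √Real.pi := Real.sqrt_pos.2 Real.pi_pos
    have e3 : (4 : ℝ) ^ (s - 1 / 2) * 2 * (2 : ℝ) ^ (1 - 2 * (s + 1 / 2)) = 1 := by
      have h4 : (4 : ℝ) ^ (s - 1 / 2) = 2 ^ (2 * (s - 1 / 2)) := by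
        rw [Real.rpow_mul (by norm_num)]; norm_num
      have h2 : (2 : ℝ) ^ (2 * (s - 1 / 2)) * (2 : ℝ) ^ (1 - 2 * (s + 1 / 2)) = 2⁻¹ := by
        rw [← Real.rpow_add (by norm_num), ← Real.rpow_neg_one]
        congr 1; ring
      rw [h4, mul_right_comm, h2]; norm_num
    have e4 : s + 1 / 2 - 1 = s - 1 / 2 := by ring
    have e5 : s + 1 / 2 + (s + 1 / 2) = 2 * (s + 1 / 2) := by ring
    rw [e1, Real.mul_rpow (by norm_num) (by nlinarith), Real.mul_rpow h0.le (by linarith), beta,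
      e4, e5]
    have key : 2 * (Real.Gamma (s + 1) / (√Real.pi * Real.Gamma (s + 1 / 2))
        * (4 : ℝ) ^ (s - 1 / 2)) =
        1 / (Real.Gamma (s + 1 / 2) * Real.Gamma (s + 1 / 2) / Real.Gamma (2 * (s + 1 / 2))) := by
      clear e1 e2 e4 e5
      generalize Real.Gamma (2 * (s + 1 / 2)) = A at *
      generalize Real.Gamma (s + 1 / 2) = B at *
      generalize Real.Gamma (s + 1) = C at *
      generalize (4 : ℝ) ^ (s - 1 / 2) = D at *
      generalize (2 : ℝ) ^ (1 - 2 * (s + 1 / 2)) = E at *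
      field_simp
      linear_combination (2 * D) * dup + (√Real.pi * A) * e3
    linear_combination (x ^ (s - 1 / 2) * (1 - x) ^ (s - 1 / 2)) * key
  · rw [if_neg h, if_neg (fun h' => h ⟨by linarith [h'.1], by linarith [h'.2]⟩), mul_zero]

lemma measurable_thetaDensity (s : ℝ) : Measurable (thetaDensity s) :=
  Measurable.ite measurableSet_Ioo (by fun_prop) (by fun_prop)

lemma isProbabilityMeasure_thetaMeasure {s : ℝ} (hs : -(1 / 2) ≤ s) :
    IsProbabilityMeasure (thetaMeasure s) := by
  unfold thetaMeasure
  split_ifs with h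
  · constructor
    simp only [Measure.smul_apply, Measure.add_apply, measure_univ, smul_eq_mul]
    rw [one_add_one_eq_two]
    exact ENNReal.inv_mul_cancel (by norm_num) (by norm_num)
  · have hs' : -(1 / 2) < s := lt_of_le_of_ne hs (Ne.symm h)
    constructor
    rw [withDensity_apply _ MeasurableSet.univ, Measure.restrict_univ,
      lintegral_affine _ (measurable_thetaDensity s).ennreal_ofReal,
      ← lintegral_betaPDF_eq_one (α := s + 1 / 2) (β := s + 1 / 2) (by linarith) (by linarith)]
    refine lintegral_congr fun x => ?_
    rw [betaPDF, ← thetaDensity_affine hs', ENNReal.ofReal_mul (by norm_num)]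
    simp

/-- `F_s`, `s ≥ -1/2`: the symmetric probability measure on `[-1, 1]` whose characteristic function
is the kernel `Λ_s`, given explicitly. It is also the law of the variable `u` in the definition of
the Kingman convolution. -/
def thetaLaw (s : ℝ) (hs : -(1 / 2) ≤ s) : ProbabilityMeasure ℝ :=
  ⟨thetaMeasure s, isProbabilityMeasure_thetaMeasure hs⟩

/-! ### Auxiliary measurability facts -/

lemma measurable_map_section {X Y Z : Type*} [MeasurableSpace X] [MeasurableSpace Y]
    [MeasurableSpace Z] (ν : Measure Y) [SFinite ν] {f : X → Y → Z}
    (hf : Measurable (Function.uncurry f)) : Measurable fun x => ν.map (f x) := by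
  have h := (Measure.measurable_map _ hf).comp (Measurable.map_prodMk_left (ν := ν) (α := X))
  convert h using 2 with x
  simp only [Function.comp_apply]
  rw [Measure.map_map hf measurable_prodMk_left]
  rfl

lemma measurable_pi_map {X Y Z : Type*} [MeasurableSpace X] [MeasurableSpace Y]
    [MeasurableSpace Z] {k : ℕ} (ν : ProbabilityMeasure Y) {f : Fin k → X → Y → Z}
    (hf : ∀ j, Measurable (Function.uncurry (f j))) :
    Measurable fun x => Measure.pi fun j => (ν : Measure Y).map (f j x) := by
  have hf' : ∀ j x, Measurable (f j x) := fun j x => (hf j).comp measurable_prodMk_left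
  have h : (fun x => Measure.pi fun j => (ν : Measure Y).map (f j x)) =
      fun x => (Measure.pi fun _ : Fin k => (ν : Measure Y)).map fun y j => f j x (y j) := by
    funext x
    have (j : Fin k) : IsProbabilityMeasure ((ν : Measure Y).map (f j x)) :=
      Measure.isProbabilityMeasure_map (hf' j x).aemeasurable
    rw [Measure.pi_map_pi fun j => (hf' j x).aemeasurable]
  rw [h]
  refine measurable_map_section _ ?_
  refine measurable_pi_lambda _ fun j => ?_
  exact (hf j).comp (measurable_fst.prodMk ((measurable_pi_apply j).comp measurable_snd))

/-! ### The `k`-dimensional Kingman convolution -/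

/-- The length `(x² + 2uxy + y²)^(1/2)`. -/
def sideLength (u : ℝ) (x y : ℝ≥0) : ℝ≥0 :=
  Real.toNNReal √((x : ℝ) ^ 2 + 2 * u * x * y + (y : ℝ) ^ 2)

lemma measurable_sideLength {X : Type*} [MeasurableSpace X] {a b : X → ℝ≥0} (ha : Measurable a)
    (hb : Measurable b) :
    Measurable (Function.uncurry fun (p : X) (u : ℝ) => sideLength u (a p) (b p)) := by
  unfold sideLength Function.uncurry
  fun_prop

/-- `δ_x ∘_s δ_y`: the law of `(x² + 2uxy + y²)^(1/2)`, where `u` has density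
`Γ(s+1) / (√π Γ(s+1/2)) (1 - u²)^(s-1/2)` on `(-1, 1)`
(for `s = -1/2`, `u = ±1` with probability `1/2` each). -/
def pointConv (s : ℝ) (hs : -(1 / 2) ≤ s) (x y : ℝ≥0) : Measure ℝ≥0 :=
  (thetaLaw s hs : Measure ℝ).map fun u => sideLength u x y

instance (s : ℝ) (hs : -(1 / 2) ≤ s) (x y : ℝ≥0) : IsProbabilityMeasure (pointConv s hs x y) :=
  Measure.isProbabilityMeasure_map (by unfold sideLength; fun_prop)

variable {k : ℕ}

/-- `δ_x ○_{s,k} δ_y = (δ_{x₁} ∘_s δ_{y₁}) × ⋯ × (δ_{x_k} ∘_s δ_{y_k})`. -/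
def pointConvPi (s : ℝ) (hs : -(1 / 2) ≤ s) (x y : Fin k → ℝ≥0) : Measure (Fin k → ℝ≥0) :=
  Measure.pi fun j => pointConv s hs (x j) (y j)

instance (s : ℝ) (hs : -(1 / 2) ≤ s) (x y : Fin k → ℝ≥0) :
    IsProbabilityMeasure (pointConvPi s hs x y) := by
  unfold pointConvPi; infer_instance

lemma measurable_pointConvPi (s : ℝ) (hs : -(1 / 2) ≤ s) :
    Measurable fun p : (Fin k → ℝ≥0) × (Fin k → ℝ≥0) => pointConvPi s hs p.1 p.2 :=
  measurable_pi_map (thetaLaw s hs)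
    (f := fun j (p : (Fin k → ℝ≥0) × (Fin k → ℝ≥0)) u => sideLength u (p.1 j) (p.2 j))
    fun j => measurable_sideLength ((measurable_pi_apply j).comp measurable_fst)
      ((measurable_pi_apply j).comp measurable_snd)

/-- The `k`-dimensional Kingman convolution
`G₁ ○_{s,k} G₂ = ∬ (δ_x ○_{s,k} δ_y) G₁(dx) G₂(dy)`. -/
def kingmanConv (s : ℝ) (hs : -(1 / 2) ≤ s) (G₁ G₂ : ProbabilityMeasure (Fin k → ℝ≥0)) :
    ProbabilityMeasure (Fin k → ℝ≥0) :=
  ⟨((G₁ : Measure (Fin k → ℝ≥0)).prod (G₂ : Measure (Fin k → ℝ≥0))).bind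
      fun p => pointConvPi s hs p.1 p.2,
    isProbabilityMeasure_bind (measurable_pointConvPi s hs).aemeasurable
      (Filter.Eventually.of_forall fun _ => inferInstance)⟩

/-- The `k`-dimensional radial characteristic function `∫ ∏ⱼ Λ_s(tⱼ xⱼ) G(dx)`. -/
def radialCharFun (s : ℝ) (G : ProbabilityMeasure (Fin k → ℝ≥0)) (t : Fin k → ℝ≥0) : ℝ :=
  ∫ x, ∏ j, kernel s (t j * x j) ∂(G : Measure (Fin k → ℝ≥0))

/-! ### The map `F_{s,k}` -/

/-- `T_{c₁} F_s × ⋯ × T_{c_k} F_s`, as a measure on Euclidean space. -/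
def scaledProduct (s : ℝ) (hs : -(1 / 2) ≤ s) (c : Fin k → ℝ≥0) :
    Measure (EuclideanSpace ℝ (Fin k)) :=
  (Measure.pi fun j => (thetaLaw s hs : Measure ℝ).map fun u => (c j : ℝ) * u).map (WithLp.toLp 2)

instance (s : ℝ) (hs : -(1 / 2) ≤ s) (c : Fin k → ℝ≥0) :
    IsProbabilityMeasure (scaledProduct s hs c) := by
  have (j : Fin k) :
      IsProbabilityMeasure ((thetaLaw s hs : Measure ℝ).map fun u => (c j : ℝ) * u) :=
    Measure.isProbabilityMeasure_map (by fun_prop)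
  exact Measure.isProbabilityMeasure_map (by fun_prop)

lemma measurable_scaledProduct (s : ℝ) (hs : -(1 / 2) ≤ s) :
    Measurable fun c : Fin k → ℝ≥0 => scaledProduct s hs c :=
  (Measure.measurable_map _ (by fun_prop)).comp
    (measurable_pi_map (thetaLaw s hs)
      (f := fun j (c : Fin k → ℝ≥0) u => (c j : ℝ) * u) fun j => by
        unfold Function.uncurry; fun_prop)

/-- `F_{s,k}(G) = ∫ T_{c₁} F_s × ⋯ × T_{c_k} F_s G(dc)`. -/
def kingmanMap (s : ℝ) (hs : -(1 / 2) ≤ s) (G : ProbabilityMeasure (Fin k → ℝ≥0)) :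
    ProbabilityMeasure (EuclideanSpace ℝ (Fin k)) :=
  ⟨(G : Measure (Fin k → ℝ≥0)).bind fun c => scaledProduct s hs c,
    isProbabilityMeasure_bind (measurable_scaledProduct s hs).aemeasurable
      (Filter.Eventually.of_forall fun _ => inferInstance)⟩

/-! ### Operations on probability measures -/

/-- The ordinary convolution of probability measures. -/
def ordConv {E : Type*} [AddMonoid E] [MeasurableSpace E] [MeasurableAdd₂ E]
    (P Q : ProbabilityMeasure E) : ProbabilityMeasure E :=
  ⟨(P : Measure E).conv (Q : Measure E), inferInstance⟩

/-- The scale change `T_c`: the law of `c X` when `X` has law `P`. -/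
def scale {E : Type*} [MeasurableSpace E] [SMul ℝ≥0 E] [MeasurableConstSMul ℝ≥0 E] (c : ℝ≥0)
    (P : ProbabilityMeasure E) : ProbabilityMeasure E :=
  P.map (f := fun x => c • x) (measurable_const_smul c).aemeasurable

/-- The convex combination `∑ᵢ wᵢ Pᵢ`. -/
def convexComb {E : Type*} [MeasurableSpace E] {n : ℕ} (w : Fin n → ℝ≥0) (hw : ∑ i, w i = 1)
    (P : Fin n → ProbabilityMeasure E) : ProbabilityMeasure E :=
  ⟨∑ i, w i • (P i : Measure E), ⟨by
    simp only [Measure.coe_finsetSum, Finset.sum_apply, Measure.smul_apply, measure_univ]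
    simp only [ENNReal.smul_def, smul_eq_mul, mul_one]
    exact_mod_cast congrArg ((↑) : ℝ≥0 → ℝ≥0∞) hw⟩⟩

/-- The unit mass at `x`. -/
def pointMass {E : Type*} [MeasurableSpace E] (x : E) : ProbabilityMeasure E :=
  ⟨Measure.dirac x, inferInstance⟩

/-! ### The Rayleigh law -/

/-- The density `2 (s+1)^(s+1) / Γ(s+1) y^(2s+1) exp(-(s+1) y²)` on `(0, ∞)`. -/
def rayleighDensity (s y : ℝ) : ℝ :=
  2 * (s + 1) ^ (s + 1) / Real.Gamma (s + 1) * y ^ (2 * s + 1) * Real.exp (-(s + 1) * y ^ 2)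

/-- The one-dimensional Rayleigh measure `σ_s`, carried by `(0, ∞)`. -/
def rayleighMeasure (s : ℝ) : Measure ℝ≥0 :=
  ((volume.restrict (Set.Ioi (0 : ℝ))).withDensity
    fun y => ENNReal.ofReal (rayleighDensity s y)).map Real.toNNReal

lemma isProbabilityMeasure_rayleighMeasure {s : ℝ} (hs : -(1 / 2) ≤ s) :
    IsProbabilityMeasure (rayleighMeasure s) := by
  have hs1 : 0 < s + 1 := by linarith
  have hG := Real.Gamma_pos_of_pos hs1
  have hP := Real.rpow_pos_of_pos hs1 (s + 1)
  have hint : ∫ y in Set.Ioi (0 : ℝ), rayleighDensity s y = 1 := by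
    have h := integral_rpow_mul_exp_neg_mul_rpow (p := 2) (q := 2 * s + 1) (b := s + 1)
      (by norm_num) (by linarith) hs1
    have e : ∀ y : ℝ, rayleighDensity s y = (2 * (s + 1) ^ (s + 1) / Real.Gamma (s + 1)) *
        (y ^ (2 * s + 1) * Real.exp (-(s + 1) * y ^ (2 : ℝ))) := fun y => by
      rw [rayleighDensity, Real.rpow_two]; ring
    simp_rw [e]
    rw [integral_const_mul, h, show (2 * s + 1 + 1) / 2 = s + 1 by ring,
      show -(2 * s + 1 + 1) / 2 = -(s + 1) by ring, Real.rpow_neg hs1.le]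
    field_simp
  have hmeas : Measurable (rayleighDensity s) := by unfold rayleighDensity; fun_prop
  have hinteg : Integrable (rayleighDensity s) (volume.restrict (Set.Ioi (0 : ℝ))) := by
    by_contra hcon
    rw [integral_undef hcon] at hint
    exact zero_ne_one hint
  have : IsProbabilityMeasure ((volume.restrict (Set.Ioi (0 : ℝ))).withDensity
      fun y => ENNReal.ofReal (rayleighDensity s y)) := by
    constructor
    rw [withDensity_apply _ MeasurableSet.univ, Measure.restrict_univ,
      ← ofReal_integral_eq_lintegral_ofReal hinteg, hint, ENNReal.ofReal_one]
    refine (ae_restrict_iff' measurableSet_Ioi).2 (Filter.Eventually.of_forall fun y hy => ?_)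
    have hy' : (0 : ℝ) < y := hy
    simp only [rayleighDensity, Pi.zero_apply]
    positivity
  exact Measure.isProbabilityMeasure_map (by fun_prop)

/-- The `k`-dimensional Rayleigh law `Σ_{s,k} = σ_s × ⋯ × σ_s`. -/
def rayleighLaw (s : ℝ) (hs : -(1 / 2) ≤ s) (k : ℕ) : ProbabilityMeasure (Fin k → ℝ≥0) :=
  ⟨Measure.pi fun _ => rayleighMeasure s,
    have := isProbabilityMeasure_rayleighMeasure hs
    inferInstance⟩

end

end Kingman

/-!
The moments of `F_s` are beta integrals, and inserting them into the exponential series gives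
`Λ_s` as the characteristic function of `F_s`. The binomial expansion of
`(x² + y² + 2 θ x y)ⁿ`, the same moments and the Chu-Vandermonde identity for the coefficients of
`Λ_s` give the product formula `E Λ_s(t √(x² + 2 θ x y + y²)) = Λ_s(t x) Λ_s(t y)`.

Hence the functions `c ↦ ∏ⱼ Λ_s(tⱼ cⱼ)` are characters of the Kingman convolution, while the
characteristic function of `F_{s,k}(G)` at `t` is their integral against `G`. The algebraic
properties of `F_{s,k}` can therefore be read off from characteristic functions.

Averaging `Λ_s(t r)` over the Rayleigh law of `r` gives the Gaussian `exp (-t² / (4 (s + 1)))`.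
So `F_{s,k}(G)` determines all the integrals `∫ exp (-∑ⱼ bⱼ cⱼ²) G(dc)`, and these determine `G`
by Stone-Weierstrass: `F_{s,k}` is injective. Finally, `F_s` is not the point mass at `0`, so a
fixed proportion of any mass of `G` far from the origin stays far from the origin in
`F_{s,k}(G)`. Preimages of tight sets are then tight, so `F_{s,k}` is proper, and a proper
continuous injection is a closed embedding.
-/

namespace Kingman

noncomputable section

/-! ### The coefficients of the Bessel kernel -/

section Combinatorics

open Polynomial Finset

lemma ascPochhammer_eval_index_add {R : Type*} [CommSemiring R] (m n : ℕ) (x : R) :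
    (ascPochhammer R (m + n)).eval x =
      (ascPochhammer R m).eval x * (ascPochhammer R n).eval (x + m) := by
  simp [← ascPochhammer_mul, eval_mul, eval_comp]

lemma ascPochhammer_eval_add_natCast {R : Type*} [CommRing R] (a b : ℕ) (x : R) :
    (ascPochhammer R a).eval (x + b) = ∑ p ∈ antidiagonal a,
      (a.choose p.1 * b.descFactorial p.1 : R) * (ascPochhammer R p.2).eval (x + p.1) := by
  have smeval_eq (m : ℕ) (r : R) :
      (descPochhammer ℤ m).smeval r = (ascPochhammer R m).eval (r - m + 1) := by
    rw [descPochhammer_smeval_eq_ascPochhammer, ascPochhammer_smeval_cast,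
      ascPochhammer_smeval_eq_eval]
  have vandermonde := Ring.descPochhammer_smeval_add (r := (b : R)) (s := x + a - 1) a
    (Commute.all _ _)
  rw [smeval_eq, show (b : R) + (x + a - 1) - a + 1 = x + b by ring] at vandermonde
  rw [vandermonde]
  refine sum_congr rfl fun p hp => ?_
  have hpa : (p.1 : R) + p.2 = a := mod_cast congrArg Nat.cast (mem_antidiagonal.1 hp)
  rw [descPochhammer_smeval_eq_descFactorial, smeval_eq, mul_assoc,
    show x + a - 1 - p.2 + 1 = x + p.1 by rw [← hpa]; ring]

/-- The coefficients `1 / (n! (s + 1)ₙ)` in `Λ_s(t) = ∑ₙ besselCoeff s n * (-(t / 2) ^ 2) ^ n`. -/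
def besselCoeff (s : ℝ) (n : ℕ) : ℝ :=
  (n.factorial * (ascPochhammer ℝ n).eval (s + 1))⁻¹

variable {s : ℝ}

lemma besselCoeff_pos (hs : -1 < s) (n : ℕ) : 0 < besselCoeff s n := by
  have := ascPochhammer_pos n (s + 1) (by linarith)
  unfold besselCoeff
  positivity

@[simp] lemma besselCoeff_zero (s : ℝ) : besselCoeff s 0 = 1 := by simp [besselCoeff]

lemma sum_besselCoeff_div_factorial (hs : -1 < s) (a b : ℕ) :
    ∑ m ∈ range (min a b + 1), besselCoeff s m / ((a - m).factorial * (b - m).factorial) =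
      besselCoeff s a * (ascPochhammer ℝ a).eval (s + 1 + b) / b.factorial := by
  have hP (m : ℕ) : (ascPochhammer ℝ m).eval (s + 1) ≠ 0 :=
    (ascPochhammer_pos m (s + 1) (by linarith)).ne'
  rw [ascPochhammer_eval_add_natCast, Nat.sum_antidiagonal_eq_sum_range_succ_mk, mul_sum, sum_div]
  refine sum_subset_zero_on_sdiff (range_mono (by simp)) (fun m hm => ?_) fun m hm => ?_
  · simp only [mem_sdiff, mem_range] at hm
    simp [Nat.descFactorial_of_lt (show b < m by omega)]
  · have hma : m ≤ a := by simp only [mem_range] at hm; omega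
    have hmb : m ≤ b := by simp only [mem_range] at hm; omega
    have hadd := ascPochhammer_eval_index_add m (a - m) (s + 1)
    rw [Nat.add_sub_cancel' hma] at hadd
    have hchoose : (a.choose m * m.factorial * (a - m).factorial : ℝ) = a.factorial :=
      mod_cast Nat.choose_mul_factorial_mul_factorial hma
    have hdesc : ((b - m).factorial * b.descFactorial m : ℝ) = b.factorial :=
      mod_cast Nat.factorial_mul_descFactorial hmb
    have ha : (ascPochhammer ℝ (a - m)).eval (s + 1 + m) ≠ 0 :=
      right_ne_zero_of_mul (hadd ▸ hP a)
    have hc : (a.choose m : ℝ) ≠ 0 := mod_cast (Nat.choose_pos hma).ne'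
    have hd : (b.descFactorial m : ℝ) ≠ 0 := mod_cast (Nat.descFactorial_pos.2 hmb).ne'
    have := hP m
    rw [besselCoeff, besselCoeff, hadd, ← hchoose, ← hdesc]
    field_simp

lemma besselCoeff_mul_besselCoeff (hs : -1 < s) (a b : ℕ) :
    besselCoeff s a * besselCoeff s b = (a + b).factorial * besselCoeff s (a + b) *
      ∑ m ∈ range (min a b + 1), besselCoeff s m / ((a - m).factorial * (b - m).factorial) := by
  have hb : (ascPochhammer ℝ b).eval (s + 1) ≠ 0 :=
    (ascPochhammer_pos b (s + 1) (by linarith)).ne'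
  have hab : (ascPochhammer ℝ (a + b)).eval (s + 1) ≠ 0 :=
    (ascPochhammer_pos (a + b) (s + 1) (by linarith)).ne'
  have hadd := ascPochhammer_eval_index_add b a (s + 1)
  rw [add_comm b a] at hadd
  rw [sum_besselCoeff_div_factorial hs, besselCoeff.eq_1 s b, besselCoeff.eq_1 s (a + b)]
  field_simp
  rw [hadd]
  ring

lemma sum_range_half_sum_antidiagonal_sub {M : Type*} [AddCommMonoid M] (n : ℕ)
    (f : ℕ → ℕ → ℕ → M) :
    ∑ m ∈ range (n / 2 + 1), ∑ p ∈ antidiagonal (n - 2 * m), f m p.1 p.2 =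
      ∑ q ∈ antidiagonal n, ∑ m ∈ range (min q.1 q.2 + 1), f m (q.1 - m) (q.2 - m) := by
  rw [sum_sigma', sum_sigma']
  refine sum_nbij' (fun x => ⟨(x.2.1 + x.1, x.2.2 + x.1), x.1⟩)
    (fun x => ⟨x.2, (x.1.1 - x.2, x.1.2 - x.2)⟩) ?_ ?_ ?_ ?_ ?_
  all_goals rintro ⟨⟩; simp
  all_goals grind

end Combinatorics

lemma besselCoeff_le {s : ℝ} (hs : -1 < s) (n : ℕ) :
    besselCoeff s n ≤ (min 1 (s + 1))⁻¹ / n.factorial := by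
  have hs' : 0 < s + 1 := by linarith
  have hmin : min 1 (s + 1) ≤ (ascPochhammer ℝ n).eval (s + 1) := by
    induction n with
    | zero => simp
    | succ n ih =>
      rw [ascPochhammer_succ_eval]
      rcases n.eq_zero_or_pos with rfl | hn
      · simp
      · have : (1 : ℝ) ≤ n := mod_cast hn
        exact ih.trans (le_mul_of_one_le_right (ascPochhammer_pos n _ hs').le (by linarith))
  rw [besselCoeff, mul_inv_rev, div_eq_mul_inv]
  gcongr

lemma summable_besselCoeff_mul_pow {s : ℝ} (hs : -1 < s) (x : ℝ) :
    Summable fun n => besselCoeff s n * x ^ n := by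
  refine ((Real.summable_pow_div_factorial |x|).mul_left (min 1 (s + 1))⁻¹).of_norm_bounded
    fun n => ?_
  rw [Real.norm_eq_abs, abs_mul, abs_pow, abs_of_pos (besselCoeff_pos hs n), mul_div_assoc',
    mul_div_right_comm]
  gcongr
  exact besselCoeff_le hs n

/-! ### Term-by-term integration of power series -/

section PowerSeries

variable {Ω 𝕜 : Type*} [MeasurableSpace Ω] {μ : Measure Ω} [RCLike 𝕜] {X f : Ω → 𝕜} {a : ℕ → 𝕜}

lemma hasSum_mul_integral_pow (hX : ∀ n, Integrable (fun ω => X ω ^ n) μ)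
    (ha : Summable fun n => ‖a n‖ * ∫ ω, ‖X ω‖ ^ n ∂μ)
    (hf : ∀ᵐ ω ∂μ, HasSum (fun n => a n * X ω ^ n) (f ω)) :
    HasSum (fun n => a n * ∫ ω, X ω ^ n ∂μ) (∫ ω, f ω ∂μ) := by
  have h := hasSum_integral_of_summable_integral_norm (fun n => (hX n).const_mul (a n))
    (by simpa only [norm_mul, norm_pow, integral_const_mul] using ha)
  simp only [integral_const_mul] at h
  rwa [integral_congr_ae (hf.mono fun ω hω => hω.tsum_eq)] at h

lemma hasSum_mul_integral_pow_of_bounded [IsFiniteMeasure μ] {C : ℝ}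
    (hX : AEStronglyMeasurable X μ) (hXC : ∀ᵐ ω ∂μ, ‖X ω‖ ≤ C)
    (ha : Summable fun n => ‖a n‖ * C ^ n)
    (hf : ∀ᵐ ω ∂μ, HasSum (fun n => a n * X ω ^ n) (f ω)) :
    HasSum (fun n => a n * ∫ ω, X ω ^ n ∂μ) (∫ ω, f ω ∂μ) := by
  have hpow (n : ℕ) : ∀ᵐ ω ∂μ, ‖X ω ^ n‖ ≤ C ^ n := hXC.mono fun ω hω => by
    rw [norm_pow]
    gcongr
  have hint (n : ℕ) : Integrable (fun ω => X ω ^ n) μ := .of_bound (hX.pow n) _ (hpow n)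
  refine hasSum_mul_integral_pow hint ?_ hf
  refine (ha.mul_right (μ.real Set.univ)).of_nonneg_of_le (fun n => by positivity) fun n => ?_
  have : ∫ ω, ‖X ω‖ ^ n ∂μ ≤ C ^ n * μ.real Set.univ := by
    rw [mul_comm, ← smul_eq_mul, ← integral_const]
    simpa only [norm_pow] using integral_mono_ae (hint n).norm (integrable_const _) (hpow n)
  rw [mul_assoc]
  gcongr

end PowerSeries

/-! ### Moments of `F_s` -/

lemma Gamma_add_natCast {x : ℝ} (hx : 0 < x) (n : ℕ) :
    Real.Gamma (x + n) = (ascPochhammer ℝ n).eval x * Real.Gamma x := by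
  induction n with
  | zero => simp
  | succ n ih =>
    rw [Nat.cast_succ, ← add_assoc, Real.Gamma_add_one (by positivity), ih, ascPochhammer_succ_eval]
    ring

lemma factorial_two_mul_eq_ascPochhammer (n : ℕ) :
    ((2 * n).factorial : ℝ) = 4 ^ n * n.factorial * (ascPochhammer ℝ n).eval (1 / 2) := by
  induction n with
  | zero => simp
  | succ n ih =>
    rw [show 2 * (n + 1) = 2 * n + 1 + 1 by ring, Nat.factorial_succ, Nat.factorial_succ,
      Nat.factorial_succ, ascPochhammer_succ_eval]
    push_cast
    rw [ih]
    ring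

lemma integral_Ioi_betaPDFReal {α β : ℝ} (hα : 0 < α) (hβ : 0 < β) :
    ∫ x in Set.Ioi (0 : ℝ), betaPDFReal α β x = 1 := by
  have hnonneg (x : ℝ) : 0 ≤ betaPDFReal α β x := by
    by_cases h : 0 < x ∧ x < 1
    · exact (betaPDFReal_pos h.1 h.2 hα hβ).le
    · simp [betaPDFReal, h]
  have hsupport : Function.support (betaPDF α β) ⊆ Set.Ioi 0 := fun x hx =>
    not_le.1 fun hx0 => hx (betaPDF_eq_zero_of_nonpos hx0)
  rw [integral_eq_lintegral_of_nonneg_ae (.of_forall hnonneg) (by fun_prop)]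
  change (∫⁻ x in Set.Ioi 0, betaPDF α β x).toReal = 1
  rw [setLIntegral_eq_of_support_subset hsupport, lintegral_betaPDF_eq_one hα hβ,
    ENNReal.toReal_one]

lemma integral_Ioi_mul_betaPDFReal_sq {α β : ℝ} (hα : 0 < α) (hβ : 0 < β) :
    ∫ u in Set.Ioi (0 : ℝ), u * betaPDFReal α β (u ^ 2) = 1 / 2 := by
  have hpow (u : ℝ) : 2 * u ^ ((2 : ℝ) - 1) = 2 * u := by norm_num
  have hsubst := integral_comp_rpow_Ioi_of_pos (g := betaPDFReal α β) two_pos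
  simp only [hpow, Real.rpow_two, smul_eq_mul, mul_assoc, integral_const_mul,
    integral_Ioi_betaPDFReal hα hβ] at hsubst
  linarith

lemma thetaDensity_neg (s u : ℝ) : thetaDensity s (-u) = thetaDensity s u := by
  simp only [thetaDensity, neg_sq, neg_lt, and_comm, neg_neg]

lemma thetaDensity_nonneg {s : ℝ} (hs : -(1 / 2) < s) (u : ℝ) : 0 ≤ thetaDensity s u := by
  unfold thetaDensity
  split_ifs with h
  · have : 0 ≤ 1 - u ^ 2 := by nlinarith [h.1, h.2]
    have := Real.Gamma_pos_of_pos (show 0 < s + 1 by linarith)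
    have := Real.Gamma_pos_of_pos (show 0 < s + 1 / 2 by linarith)
    positivity
  · exact le_rfl

lemma thetaDensity_mul_pow_two_mul {s : ℝ} (hs : -(1 / 2) < s) {u : ℝ} (hu : 0 < u) (n : ℕ) :
    thetaDensity s u * u ^ (2 * n) =
      Real.Gamma (s + 1) / (√Real.pi * Real.Gamma (s + 1 / 2)) * beta (n + 1 / 2) (s + 1 / 2) *
        (u * betaPDFReal (n + 1 / 2) (s + 1 / 2) (u ^ 2)) := by
  have hbeta : beta (n + 1 / 2) (s + 1 / 2) ≠ 0 :=
    (beta_pos (by positivity) (by linarith)).ne'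
  have hpow : u * (u ^ 2) ^ ((n : ℝ) + 1 / 2 - 1) = u ^ (2 * n) := by
    rw [← Real.rpow_natCast_mul hu.le, ← Real.rpow_natCast]
    nth_rewrite 1 [← Real.rpow_one u]
    rw [← Real.rpow_add hu]
    push_cast
    ring_nf
  by_cases hu1 : u < 1
  · rw [thetaDensity, betaPDFReal, if_pos ⟨by linarith, hu1⟩,
      if_pos ⟨by positivity, by nlinarith⟩, ← hpow, show s + 1 / 2 - 1 = s - 1 / 2 by ring]
    generalize beta (n + 1 / 2) (s + 1 / 2) = B at *
    field_simp
  · rw [thetaDensity, betaPDFReal, if_neg fun h => hu1 h.2,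
      if_neg fun h => hu1 (by nlinarith [h.2])]
    ring

lemma isNegInvariant_withDensity {G : Type*} [MeasurableSpace G] [InvolutiveNeg G]
    [MeasurableNeg G] {μ : Measure G} [μ.IsNegInvariant] {f : G → ℝ≥0∞} (hf : Measurable f)
    (hneg : ∀ x, f (-x) = f x) : (μ.withDensity f).IsNegInvariant where
  neg_eq_self := by
    refine Measure.ext_of_lintegral _ fun g hg => ?_
    rw [Measure.neg, lintegral_map hg measurable_neg,
      lintegral_withDensity_eq_lintegral_mul _ hf (by fun_prop),
      lintegral_withDensity_eq_lintegral_mul _ hf hg, ← lintegral_neg_eq_self]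
    simp only [Pi.mul_apply, hneg, neg_neg]

instance isNegInvariant_thetaMeasure (s : ℝ) : (thetaMeasure s).IsNegInvariant := by
  unfold thetaMeasure
  split_ifs with h
  · constructor
    rw [Measure.neg]
    simp only [Measure.map_smul, Measure.map_add _ _ measurable_neg,
      Measure.map_dirac' measurable_neg, neg_neg, add_comm]
  · exact isNegInvariant_withDensity (measurable_thetaDensity s).ennreal_ofReal
      fun u => by rw [thetaDensity_neg]

lemma integral_thetaMeasure {s : ℝ} (hs : -(1 / 2) < s) (g : ℝ → ℝ) :
    ∫ u, g u ∂thetaMeasure s = ∫ u, thetaDensity s u * g u := by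
  rw [thetaMeasure, if_neg hs.ne', integral_withDensity_eq_integral_toReal_smul
    (measurable_thetaDensity s).ennreal_ofReal (by simp)]
  simp only [ENNReal.toReal_ofReal (thetaDensity_nonneg hs _), smul_eq_mul]

lemma integral_thetaMeasure_neg_half (g : ℝ → ℝ) :
    ∫ u, g u ∂thetaMeasure (-(1 / 2)) = (g 1 + g (-1)) / 2 := by
  rw [thetaMeasure, if_pos rfl, integral_smul_measure,
    integral_add_measure (integrable_dirac (by simp)) (integrable_dirac (by simp))]
  simp [div_eq_inv_mul]

lemma ae_abs_le_one_thetaMeasure (s : ℝ) : ∀ᵐ u ∂thetaMeasure s, |u| ≤ 1 := by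
  unfold thetaMeasure
  split_ifs with h
  · refine Measure.ae_smul_measure ?_ _
    simp [ae_add_measure_iff]
  · rw [ae_withDensity_iff (measurable_thetaDensity s).ennreal_ofReal]
    refine .of_forall fun u => not_imp_comm.1 fun hu => ?_
    rw [thetaDensity, if_neg fun h => hu (abs_le.2 ⟨h.1.le, h.2.le⟩), ENNReal.ofReal_zero]

lemma integral_pow_thetaMeasure_of_odd (s : ℝ) {n : ℕ} (hn : Odd n) :
    ∫ u, u ^ n ∂thetaMeasure s = 0 := by
  have := integral_neg_eq_self (fun u : ℝ => u ^ n) (thetaMeasure s)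
  simp only [hn.neg_pow, integral_neg] at this
  linarith

lemma integral_pow_two_mul_thetaMeasure {s : ℝ} (hs : -(1 / 2) ≤ s) (n : ℕ) :
    ∫ u, u ^ (2 * n) ∂thetaMeasure s = (2 * n).factorial / 4 ^ n * besselCoeff s n := by
  rw [factorial_two_mul_eq_ascPochhammer, besselCoeff]
  have hs1 := ascPochhammer_pos n (s + 1) (by linarith)
  have hhalf := ascPochhammer_pos n (1 / 2 : ℝ) (by norm_num)
  rcases hs.eq_or_lt with rfl | hs
  · rw [integral_thetaMeasure_neg_half, (even_two_mul n).neg_pow,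
      show -(1 / 2) + 1 = (1 / 2 : ℝ) by norm_num]
    field_simp
    norm_num
  · have heven (u : ℝ) : thetaDensity s u * u ^ (2 * n) = thetaDensity s |u| * |u| ^ (2 * n) := by
      rw [(even_two_mul n).pow_abs]
      rcases abs_choice u with h | h <;> rw [h]
      rw [thetaDensity_neg]
    have hGamma := Real.Gamma_pos_of_pos (show 0 < s + 1 by linarith)
    have hGamma' := Real.Gamma_pos_of_pos (show 0 < s + 1 / 2 by linarith)
    rw [integral_thetaMeasure hs, integral_congr_ae (.of_forall heven),
      integral_comp_abs (f := fun u => thetaDensity s u * u ^ (2 * n)),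
      setIntegral_congr_fun measurableSet_Ioi
        fun u hu => thetaDensity_mul_pow_two_mul hs (Set.mem_Ioi.1 hu) n,
      integral_const_mul, integral_Ioi_mul_betaPDFReal_sq (by positivity) (by linarith), beta,
      show (n : ℝ) + 1 / 2 + (s + 1 / 2) = s + 1 + n by ring, add_comm (n : ℝ) (1 / 2),
      Gamma_add_natCast (show 0 < s + 1 by linarith), Gamma_add_natCast one_half_pos,
      Real.Gamma_one_half_eq]
    generalize Real.Gamma (s + 1 / 2) = Γ at *
    field_simp

/-! ### The Bessel kernel as a characteristic function -/

section Kernel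

variable {s : ℝ}

/-- The even extension of `Λ_s` to the real line. The power `(x / 2) ^ s` in `kernel` is a junk
value for negative `x`, whereas characteristic functions are evaluated at arbitrary reals. -/
def evenKernel (s t : ℝ) : ℝ := kernel s |t|

lemma evenKernel_of_nonneg (s : ℝ) {t : ℝ} (ht : 0 ≤ t) : evenKernel s t = kernel s t := by
  rw [evenKernel, abs_of_nonneg ht]

lemma evenKernel_zero (s : ℝ) : evenKernel s 0 = 1 := by simp [evenKernel, kernel]

lemma kernel_summand (hs : -1 < s) {x : ℝ} (hx : 0 < x) (n : ℕ) :
    Real.Gamma (s + 1) * ((-1) ^ n * (x / 2) ^ (s + 2 * n) /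
      (n.factorial * Real.Gamma (s + n + 1))) / (x / 2) ^ s =
      besselCoeff s n * (-(x / 2) ^ 2) ^ n := by
  have hs1 : 0 < s + 1 := by linarith
  have hGamma := (Real.Gamma_pos_of_pos hs1).ne'
  have hasc := (ascPochhammer_pos n (s + 1) hs1).ne'
  have hpow := (Real.rpow_pos_of_pos (half_pos hx) s).ne'
  rw [Real.rpow_add (half_pos hx), show (2 * n : ℝ) = (2 * n : ℕ) by push_cast; rfl,
    Real.rpow_natCast, pow_mul, show s + n + 1 = s + 1 + n by ring, Gamma_add_natCast hs1,
    besselCoeff, neg_pow ((x / 2) ^ 2)]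
  field_simp

lemma hasSum_evenKernel (hs : -1 < s) (t : ℝ) :
    HasSum (fun n => besselCoeff s n * (-(t / 2) ^ 2) ^ n) (evenKernel s t) := by
  rcases eq_or_ne t 0 with rfl | ht
  · rw [evenKernel_zero]
    convert hasSum_single (f := fun n => besselCoeff s n * (-(0 / 2) ^ 2) ^ n) 0
      fun n hn => by simp [hn]
    simp
  · have htsum : evenKernel s t = ∑' n, besselCoeff s n * (-(t / 2) ^ 2) ^ n := by
      have ht' := abs_pos.2 ht
      rw [evenKernel, kernel, if_neg ht'.ne', besselJ, ← tsum_mul_left, ← tsum_div_const]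
      simp only [kernel_summand hs ht', div_pow, sq_abs]
    exact htsum ▸ (summable_besselCoeff_mul_pow hs _).hasSum

lemma hasSum_charFun_thetaMeasure (hs : -(1 / 2) ≤ s) (t : ℝ) :
    HasSum (fun n : ℕ => (t * Complex.I) ^ n / n.factorial *
      ((∫ u, u ^ n ∂thetaMeasure s : ℝ) : ℂ)) (charFun (thetaMeasure s) t) := by
  have := isProbabilityMeasure_thetaMeasure hs
  have h := hasSum_mul_integral_pow_of_bounded (μ := thetaMeasure s) (X := fun u : ℝ => (u : ℂ))
    (f := fun u : ℝ => Complex.exp (t * u * Complex.I))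
    (a := fun n => (t * Complex.I) ^ n / n.factorial) (C := 1)
    Complex.measurable_ofReal.aestronglyMeasurable
    ((ae_abs_le_one_thetaMeasure s).mono fun u hu => by rwa [Complex.norm_real])
    (by simpa using Real.summable_pow_div_factorial |t|)
    (.of_forall fun u => by
      rw [mul_right_comm, Complex.exp_eq_exp_ℂ]
      convert NormedSpace.expSeries_div_hasSum_exp (t * Complex.I * u : ℂ) using 2 with n
      rw [mul_pow _ (u : ℂ), div_mul_eq_mul_div])
  rw [charFun_apply_real]
  simpa only [← Complex.ofReal_pow, integral_complex_ofReal] using h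

lemma charFun_thetaMeasure (hs : -(1 / 2) ≤ s) (t : ℝ) :
    charFun (thetaMeasure s) t = (evenKernel s t : ℂ) := by
  have hkernel := Complex.hasSum_ofReal.2 (hasSum_evenKernel (show -1 < s by linarith) t)
  refine ((Function.Injective.hasSum_iff (mul_right_injective₀ (two_ne_zero' ℕ))
    fun n hn => ?_).2 (hasSum_charFun_thetaMeasure hs t)).unique ?_
  · have hodd : Odd n := by
      rw [← Nat.not_even_iff_odd]
      exact fun h => hn ⟨n / 2, Nat.two_mul_div_two_of_even h⟩
    rw [integral_pow_thetaMeasure_of_odd s hodd, Complex.ofReal_zero, mul_zero]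
  · convert hkernel using 2 with n
    have hfact : ((2 * n).factorial : ℂ) ≠ 0 := mod_cast (2 * n).factorial_ne_zero
    have hpow : (t * Complex.I) ^ (2 * n) = 4 ^ n * (-(t / 2) ^ 2 : ℂ) ^ n := by
      rw [pow_mul, ← mul_pow, mul_pow, Complex.I_sq]
      ring
    rw [Function.comp_apply, integral_pow_two_mul_thetaMeasure hs, hpow]
    push_cast
    field_simp

lemma abs_evenKernel_le_one (hs : -(1 / 2) ≤ s) (t : ℝ) : |evenKernel s t| ≤ 1 := by
  have := isProbabilityMeasure_thetaMeasure hs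
  simpa only [charFun_thetaMeasure hs, Complex.norm_real, Real.norm_eq_abs] using
    norm_charFun_le_one (μ := thetaMeasure s) t

lemma continuous_evenKernel (hs : -(1 / 2) ≤ s) : Continuous (evenKernel s) := by
  have := isProbabilityMeasure_thetaMeasure hs
  have h : evenKernel s = fun t => (charFun (thetaMeasure s) t).re := by
    simp only [charFun_thetaMeasure hs, Complex.ofReal_re]
  exact h ▸ Complex.continuous_re.comp continuous_charFun

end Kernel

/-! ### The product formula -/

section ProductFormula

open Finset

variable {s : ℝ}

lemma integrable_pow_thetaMeasure (hs : -(1 / 2) ≤ s) (n : ℕ) :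
    Integrable (fun u : ℝ => u ^ n) (thetaMeasure s) := by
  have := isProbabilityMeasure_thetaMeasure hs
  refine .of_bound (by fun_prop) 1 ((ae_abs_le_one_thetaMeasure s).mono fun u hu => ?_)
  rw [norm_pow, Real.norm_eq_abs]
  exact pow_le_one₀ (abs_nonneg u) hu

lemma sum_range_eq_sum_even {M : Type*} [AddCommMonoid M] (n : ℕ) {f : ℕ → M}
    (hf : ∀ j, Odd j → f j = 0) :
    ∑ j ∈ range (n + 1), f j = ∑ m ∈ range (n / 2 + 1), f (2 * m) := by
  rw [← sum_image (g := (2 * ·)) (f := f) (mul_right_injective₀ two_ne_zero).injOn]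
  refine (sum_subset (fun j hj => ?_) fun j hj hj' => hf j ?_).symm
  · simp only [mem_image, mem_range] at hj ⊢
    omega
  · simp only [mem_image, mem_range] at hj hj'
    exact Nat.not_even_iff_odd.1 fun ⟨r, hr⟩ => hj' ⟨r, by omega, by omega⟩

lemma integral_add_mul_pow_thetaMeasure (hs : -(1 / 2) ≤ s) (n : ℕ) (A B : ℝ) :
    ∫ u, (2 * B * u + A) ^ n ∂thetaMeasure s = n.factorial *
      ∑ m ∈ range (n / 2 + 1), besselCoeff s m * B ^ (2 * m) *
        (A ^ (n - 2 * m) / (n - 2 * m).factorial) := by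
  simp only [add_pow, mul_pow _ (_ : ℝ)]
  rw [integral_finsetSum _ fun j _ =>
    (((integrable_pow_thetaMeasure hs j).const_mul _).mul_const _).mul_const _]
  simp only [integral_mul_const, integral_const_mul]
  rw [sum_range_eq_sum_even n fun j hj => by simp [integral_pow_thetaMeasure_of_odd s hj], mul_sum]
  refine sum_congr rfl fun m hm => ?_
  have hchoose : (n.choose (2 * m) * (2 * m).factorial * (n - 2 * m).factorial : ℝ) =
      n.factorial := mod_cast Nat.choose_mul_factorial_mul_factorial
        (by simp only [mem_range] at hm; omega)
  rw [integral_pow_two_mul_thetaMeasure hs, ← hchoose, pow_mul 2, show (2 : ℝ) ^ 2 = 4 by norm_num]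
  field_simp

lemma add_pow_div_factorial {K : Type*} [Field K] [CharZero K] (x y : K) (n : ℕ) :
    (x + y) ^ n / n.factorial =
      ∑ p ∈ antidiagonal n, x ^ p.1 / p.1.factorial * (y ^ p.2 / p.2.factorial) := by
  rw [(Commute.all x y).add_pow', sum_div]
  refine sum_congr rfl fun p hp => ?_
  have hfact : (n.choose p.1 * p.1.factorial * p.2.factorial : K) = n.factorial := by
    rw [← mem_antidiagonal.1 hp, Nat.choose_symm_add]
    exact mod_cast Nat.add_choose_mul_factorial_mul_factorial p.1 p.2
  have h1 : (p.1.factorial : K) ≠ 0 := mod_cast p.1.factorial_ne_zero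
  have h2 : (p.2.factorial : K) ≠ 0 := mod_cast p.2.factorial_ne_zero
  have h : (n.factorial : K) ≠ 0 := mod_cast n.factorial_ne_zero
  rw [nsmul_eq_mul]
  field_simp
  rw [← hfact]
  ring

lemma besselCoeff_mul_integral_pow_thetaMeasure (hs : -(1 / 2) ≤ s) (n : ℕ) (x y : ℝ) :
    besselCoeff s n * ∫ u, (2 * (x * y) * u + (x ^ 2 + y ^ 2)) ^ n ∂thetaMeasure s =
      ∑ q ∈ antidiagonal n,
        besselCoeff s q.1 * (x ^ 2) ^ q.1 * (besselCoeff s q.2 * (y ^ 2) ^ q.2) := by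
  rw [integral_add_mul_pow_thetaMeasure hs]
  simp only [add_pow_div_factorial, mul_sum (antidiagonal _)]
  rw [sum_range_half_sum_antidiagonal_sub n fun m i j => besselCoeff s m * (x * y) ^ (2 * m) *
    ((x ^ 2) ^ i / i.factorial * ((y ^ 2) ^ j / j.factorial)), mul_sum, mul_sum]
  refine sum_congr rfl fun q hq => ?_
  rw [mul_mul_mul_comm, besselCoeff_mul_besselCoeff (by linarith), mem_antidiagonal.1 hq,
    ← mul_assoc, mul_comm (n.factorial : ℝ), mul_assoc (_ * _), sum_mul]
  congr 1
  refine sum_congr rfl fun m hm => ?_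
  simp only [mem_range] at hm
  obtain ⟨i, hi⟩ := Nat.exists_eq_add_of_le (show m ≤ q.1 by omega)
  obtain ⟨j, hj⟩ := Nat.exists_eq_add_of_le (show m ≤ q.2 by omega)
  rw [hi, hj, Nat.add_sub_cancel_left, Nat.add_sub_cancel_left]
  ring

lemma sq_add_nonneg {u : ℝ} (hu : |u| ≤ 1) (x y : ℝ) : 0 ≤ x ^ 2 + 2 * u * x * y + y ^ 2 := by
  obtain ⟨h1, h2⟩ := abs_le.1 hu
  nlinarith [mul_nonneg (sub_nonneg.2 h2) (sq_nonneg (x - y)),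
    mul_nonneg (neg_le_iff_add_nonneg.1 h1) (sq_nonneg (x + y))]

lemma sideLength_sq {u : ℝ} (hu : |u| ≤ 1) (x y : ℝ≥0) :
    (sideLength u x y : ℝ) ^ 2 = 2 * (x * y) * u + ((x : ℝ) ^ 2 + (y : ℝ) ^ 2) := by
  rw [sideLength, Real.coe_toNNReal _ (Real.sqrt_nonneg _), Real.sq_sqrt (sq_add_nonneg hu _ _)]
  ring

lemma sideLength_le {u : ℝ} (hu : |u| ≤ 1) (x y : ℝ≥0) : (sideLength u x y : ℝ) ≤ x + y := by
  refine (sq_le_sq₀ (by positivity) (by positivity)).1 ?_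
  rw [sideLength_sq hu]
  have := mul_le_mul_of_nonneg_left (abs_le.1 hu).2 (show (0 : ℝ) ≤ x * y by positivity)
  linarith

lemma measurable_sideLength_left (x y : ℝ≥0) : Measurable fun u => sideLength u x y := by
  unfold sideLength; fun_prop

lemma besselCoeff_mul_integral_sideLength_pow (hs : -(1 / 2) ≤ s) (t : ℝ) (x y : ℝ≥0) (n : ℕ) :
    besselCoeff s n * ∫ u, (-(t * sideLength u x y / 2) ^ 2) ^ n ∂thetaMeasure s =
      ∑ q ∈ antidiagonal n, besselCoeff s q.1 * (-(t * x / 2) ^ 2) ^ q.1 *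
        (besselCoeff s q.2 * (-(t * y / 2) ^ 2) ^ q.2) := by
  have hL : ∫ u, (-(t * sideLength u x y / 2) ^ 2) ^ n ∂thetaMeasure s = (-(t / 2) ^ 2) ^ n *
      ∫ u, (2 * (x * y) * u + ((x : ℝ) ^ 2 + (y : ℝ) ^ 2)) ^ n ∂thetaMeasure s := by
    rw [← integral_const_mul]
    refine integral_congr_ae ((ae_abs_le_one_thetaMeasure s).mono fun u hu => ?_)
    dsimp only
    rw [← sideLength_sq hu, ← mul_pow]
    ring
  rw [hL, mul_left_comm, besselCoeff_mul_integral_pow_thetaMeasure hs, mul_sum]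
  refine sum_congr rfl fun q hq => ?_
  have hx : -(t * x / 2) ^ 2 = -(t / 2) ^ 2 * (x : ℝ) ^ 2 := by ring
  have hy : -(t * y / 2) ^ 2 = -(t / 2) ^ 2 * (y : ℝ) ^ 2 := by ring
  rw [hx, hy, mul_pow, mul_pow, ← mem_antidiagonal.1 hq, pow_add]
  ring

lemma integral_evenKernel_sideLength (hs : -(1 / 2) ≤ s) (t : ℝ) (x y : ℝ≥0) :
    ∫ u, evenKernel s (t * sideLength u x y) ∂thetaMeasure s =
      evenKernel s (t * x) * evenKernel s (t * y) := by
  have := isProbabilityMeasure_thetaMeasure hs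
  have hs1 : -1 < s := by linarith
  have hL := hasSum_mul_integral_pow_of_bounded (μ := thetaMeasure s) (a := besselCoeff s)
    (X := fun u => -(t * sideLength u x y / 2) ^ 2) (C := (|t| * (x + y) / 2) ^ 2)
    (by have := measurable_sideLength_left x y; fun_prop)
    ((ae_abs_le_one_thetaMeasure s).mono fun u hu => by
      rw [norm_neg, norm_pow, norm_div, norm_mul, Real.norm_ofNat, NNReal.norm_eq, Real.norm_eq_abs]
      gcongr
      exact sideLength_le hu x y)
    (by simpa only [Real.norm_of_nonneg (besselCoeff_pos hs1 _).le] using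
      summable_besselCoeff_mul_pow hs1 _)
    (.of_forall fun u => hasSum_evenKernel hs1 _)
  simp only [besselCoeff_mul_integral_sideLength_pow hs] at hL
  rw [← hL.tsum_eq, ← (hasSum_evenKernel hs1 (t * x)).tsum_eq,
    ← (hasSum_evenKernel hs1 (t * y)).tsum_eq]
  exact (tsum_mul_tsum_eq_tsum_sum_antidiagonal_of_summable_norm
    (summable_besselCoeff_mul_pow hs1 _).norm (summable_besselCoeff_mul_pow hs1 _).norm).symm

end ProductFormula

/-! ### The Rayleigh transform -/

section Rayleigh

variable {s : ℝ}

lemma rayleighDensity_nonneg (hs : -1 < s) {y : ℝ} (hy : 0 ≤ y) : 0 ≤ rayleighDensity s y := by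
  have hs1 : 0 < s + 1 := by linarith
  have := Real.Gamma_pos_of_pos hs1
  unfold rayleighDensity
  positivity

lemma measurable_rayleighDensity (s : ℝ) : Measurable (rayleighDensity s) := by
  unfold rayleighDensity; fun_prop

lemma integral_rayleighMeasure (hs : -1 < s) {g : ℝ → ℝ} (hg : Measurable g) :
    ∫ r, g r ∂rayleighMeasure s = ∫ y in Set.Ioi (0 : ℝ), rayleighDensity s y * g y := by
  have hg' : Measurable fun r : ℝ≥0 => g r := hg.comp measurable_coe_nnreal_real
  rw [rayleighMeasure, integral_map (by fun_prop) hg'.aestronglyMeasurable,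
    integral_withDensity_eq_integral_toReal_smul
      (measurable_rayleighDensity s).ennreal_ofReal (by simp)]
  refine setIntegral_congr_fun measurableSet_Ioi fun y hy => ?_
  have hy : 0 ≤ y := (Set.mem_Ioi.1 hy).le
  simp only [smul_eq_mul, ENNReal.toReal_ofReal (rayleighDensity_nonneg hs hy),
    Real.coe_toNNReal _ hy]

lemma integral_sq_pow_rayleighMeasure (hs : -1 < s) (n : ℕ) :
    ∫ r, ((r : ℝ) ^ 2) ^ n ∂rayleighMeasure s =
      (ascPochhammer ℝ n).eval (s + 1) / (s + 1) ^ n := by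
  have hs1 : 0 < s + 1 := by linarith
  have hdensity : ∀ y ∈ Set.Ioi (0 : ℝ), rayleighDensity s y * (y ^ 2) ^ n =
      (2 * (s + 1) ^ (s + 1) / Real.Gamma (s + 1)) *
        (y ^ (2 * s + 1 + 2 * n) * Real.exp (-(s + 1) * y ^ (2 : ℝ))) := fun y hy => by
    rw [rayleighDensity, Real.rpow_two, Real.rpow_add (Set.mem_Ioi.1 hy) (2 * s + 1),
      show (2 * n : ℝ) = (2 * n : ℕ) by push_cast; rfl, Real.rpow_natCast, pow_mul]
    ring
  have hexponent : -1 < 2 * s + 1 + 2 * n := by linarith [(Nat.cast_nonneg n : (0 : ℝ) ≤ n)]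
  rw [integral_rayleighMeasure hs (g := fun y => (y ^ 2) ^ n) (by fun_prop),
    setIntegral_congr_fun measurableSet_Ioi hdensity, integral_const_mul,
    integral_rpow_mul_exp_neg_mul_rpow two_pos hexponent hs1,
    show (2 * s + 1 + 2 * n + 1) / 2 = s + 1 + n by ring,
    show -(2 * s + 1 + 2 * n + 1) / 2 = -(s + 1) - n by ring, Real.rpow_sub hs1,
    Real.rpow_neg hs1.le, Real.rpow_natCast, Gamma_add_natCast hs1]
  have := Real.Gamma_pos_of_pos hs1
  have := Real.rpow_pos_of_pos hs1 (s + 1)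
  field_simp

lemma integrable_sq_pow_rayleighMeasure (hs : -1 < s) (n : ℕ) :
    Integrable (fun r : ℝ≥0 => ((r : ℝ) ^ 2) ^ n) (rayleighMeasure s) := by
  have hs1 : 0 < s + 1 := by linarith
  have hasc := ascPochhammer_pos n (s + 1) hs1
  refine .of_integral_ne_zero ?_
  rw [integral_sq_pow_rayleighMeasure hs]
  positivity

lemma integral_evenKernel_rayleighMeasure (hs : -1 < s) (t : ℝ) :
    ∫ r : ℝ≥0, evenKernel s (t * r) ∂rayleighMeasure s = Real.exp (-(t ^ 2 / (4 * (s + 1)))) := by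
  have hs1 : 0 < s + 1 := by linarith
  have hterm (n : ℕ) (z : ℝ) : besselCoeff s n * z ^ n *
      ((ascPochhammer ℝ n).eval (s + 1) / (s + 1) ^ n) = (z / (s + 1)) ^ n / n.factorial := by
    have hasc := (ascPochhammer_pos n (s + 1) hs1).ne'
    rw [besselCoeff, div_pow]
    field_simp
  have hsum := hasSum_mul_integral_pow (μ := rayleighMeasure s) (X := fun r => (r : ℝ) ^ 2)
    (f := fun r => evenKernel s (t * r)) (a := fun n => besselCoeff s n * (-(t / 2) ^ 2) ^ n)
    (integrable_sq_pow_rayleighMeasure hs)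
    (by
      simp only [norm_mul, norm_pow, norm_neg, NNReal.norm_eq, integral_sq_pow_rayleighMeasure hs,
        Real.norm_of_nonneg (besselCoeff_pos hs _).le, hterm]
      exact Real.summable_pow_div_factorial _)
    (.of_forall fun r => by
      have hbase : -(t / 2) ^ 2 * (r : ℝ) ^ 2 = -(t * r / 2) ^ 2 := by ring
      simpa only [mul_assoc, ← mul_pow, hbase] using hasSum_evenKernel hs (t * r))
  simp only [integral_sq_pow_rayleighMeasure hs, hterm] at hsum
  rw [Real.exp_eq_exp_ℝ, show -(t ^ 2 / (4 * (s + 1))) = -(t / 2) ^ 2 / (s + 1) by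
    rw [mul_comm 4, neg_div, div_pow, div_div, mul_comm]; norm_num]
  exact hsum.unique (NormedSpace.expSeries_div_hasSum_exp _)

end Rayleigh

/-! ### Mixtures of probability measures -/

section Mixtures

variable {α β : Type*} [MeasurableSpace α] [MeasurableSpace β]

lemma integral_bind {F : Type*} [NormedAddCommGroup F] [NormedSpace ℝ F] {μ : Measure α}
    {κ : α → Measure β} (hκ : Measurable κ) {f : β → F} (hf : Integrable f (μ.bind κ)) :
    ∫ y, f y ∂μ.bind κ = ∫ x, ∫ y, f y ∂κ x ∂μ := by
  have hcomp : μ.bind κ = ((⟨κ, hκ⟩ : Kernel α β) ∘ₖ Kernel.const Unit μ) () := by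
    rw [← Measure.comp_eq_comp_const_apply]
    rfl
  rw [hcomp] at hf ⊢
  rw [Kernel.integral_comp hf, Kernel.const_apply]
  rfl

lemma charFun_bind {E : Type*} [NormedAddCommGroup E] [InnerProductSpace ℝ E] [MeasurableSpace E]
    [BorelSpace E] {μ : Measure α} {κ : α → Measure E} (hκ : Measurable κ)
    [IsFiniteMeasure (μ.bind κ)] (t : E) :
    charFun (μ.bind κ) t = ∫ x, charFun (κ x) t ∂μ := by
  simp only [charFun_eq_integral_innerProbChar]
  exact integral_bind hκ ((BoundedContinuousFunction.innerProbChar t).integrable _)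

lemma mul_measure_le_bind {μ : Measure α} {κ : α → Measure β} (hκ : Measurable κ) {A : Set α}
    {B : Set β} (hB : MeasurableSet B) {q : ℝ≥0∞}
    (h : ∀ x ∈ A, q ≤ κ x B) : q * μ A ≤ μ.bind κ B := by
  rw [Measure.bind_apply hB hκ.aemeasurable]
  calc q * μ A ≤ q * μ {x | q ≤ κ x B} := by gcongr; exact h
    _ ≤ ∫⁻ x, κ x B ∂μ := mul_meas_ge_le_lintegral ((Measure.measurable_coe hB).comp hκ) q

end Mixtures

/-! ### Fourier transforms -/

section Fourier

variable {s : ℝ} {k : ℕ}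

/-- The product `∏ⱼ Λ_s(|tⱼ| cⱼ)`. As a function of `c` it is a character of the Kingman
convolution, as a function of `t` it is the characteristic function of `scaledProduct s hs c`. -/
def radialKernel (s : ℝ) (t : Fin k → ℝ) (c : Fin k → ℝ≥0) : ℝ := ∏ j, evenKernel s (t j * c j)

lemma continuous_radialKernel (hs : -(1 / 2) ≤ s) :
    Continuous fun p : (Fin k → ℝ) × (Fin k → ℝ≥0) => radialKernel s p.1 p.2 :=
  continuous_finsetProd _ fun j _ => (continuous_evenKernel hs).comp (by fun_prop)

lemma measurable_radialKernel (hs : -(1 / 2) ≤ s) (t : Fin k → ℝ) :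
    Measurable (radialKernel s t) :=
  ((continuous_radialKernel hs).comp (.prodMk_right t)).measurable

lemma norm_radialKernel_le_one (hs : -(1 / 2) ≤ s) (t : Fin k → ℝ) (c : Fin k → ℝ≥0) :
    ‖radialKernel s t c‖ ≤ 1 := by
  rw [radialKernel, norm_prod]
  exact Finset.prod_le_one (fun _ _ => norm_nonneg _) fun _ _ => abs_evenKernel_le_one hs _

lemma charFun_scaledProduct (hs : -(1 / 2) ≤ s) (c : Fin k → ℝ≥0)
    (t : EuclideanSpace ℝ (Fin k)) :
    charFun (scaledProduct s hs c) t = (radialKernel s t c : ℂ) := by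
  have (j : Fin k) :
      IsProbabilityMeasure ((thetaLaw s hs : Measure ℝ).map fun u => (c j : ℝ) * u) :=
    Measure.isProbabilityMeasure_map (by fun_prop)
  simp_rw [scaledProduct, charFun_pi, charFun_map_mul, mul_comm (c _ : ℝ)]
  rw [radialKernel, Complex.ofReal_prod]
  exact Finset.prod_congr rfl fun j _ => charFun_thetaMeasure hs _

lemma coe_kingmanMap (s : ℝ) (hs : -(1 / 2) ≤ s) (G : ProbabilityMeasure (Fin k → ℝ≥0)) :
    (kingmanMap s hs G : Measure (EuclideanSpace ℝ (Fin k))) =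
      (G : Measure (Fin k → ℝ≥0)).bind fun c => scaledProduct s hs c := rfl

lemma charFun_kingmanMap (hs : -(1 / 2) ≤ s) (G : ProbabilityMeasure (Fin k → ℝ≥0))
    (t : EuclideanSpace ℝ (Fin k)) :
    charFun (kingmanMap s hs G : Measure (EuclideanSpace ℝ (Fin k))) t =
      ((∫ c, radialKernel s t c ∂(G : Measure (Fin k → ℝ≥0)) : ℝ) : ℂ) := by
  rw [← integral_complex_ofReal]
  simp only [← charFun_scaledProduct hs]
  have : IsProbabilityMeasure ((G : Measure (Fin k → ℝ≥0)).bind fun c => scaledProduct s hs c) :=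
    (kingmanMap s hs G).prop
  rw [coe_kingmanMap, charFun_bind (measurable_scaledProduct s hs)]

lemma kingmanMap_eq_of_charFun (hs : -(1 / 2) ≤ s) {G : ProbabilityMeasure (Fin k → ℝ≥0)}
    {P : ProbabilityMeasure (EuclideanSpace ℝ (Fin k))}
    (h : ∀ t, charFun (P : Measure (EuclideanSpace ℝ (Fin k))) t =
      ((∫ c, radialKernel s t c ∂(G : Measure (Fin k → ℝ≥0)) : ℝ) : ℂ)) :
    kingmanMap s hs G = P := by
  refine Subtype.ext (?_ : (kingmanMap s hs G : Measure (EuclideanSpace ℝ (Fin k))) = P)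
  exact Measure.ext_of_charFun (funext fun t => (charFun_kingmanMap hs G t).trans (h t).symm)

lemma radialCharFun_eq_charFun (hs : -(1 / 2) ≤ s) (G : ProbabilityMeasure (Fin k → ℝ≥0))
    (t : Fin k → ℝ≥0) :
    (radialCharFun s G t : ℂ) =
      charFun (kingmanMap s hs G : Measure (EuclideanSpace ℝ (Fin k)))
        (WithLp.toLp 2 fun j => (t j : ℝ)) := by
  rw [charFun_kingmanMap hs, radialCharFun]
  congr! with c
  exact Finset.prod_congr rfl fun j _ => (evenKernel_of_nonneg s (by positivity)).symm

end Fourier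

/-! ### `F_{s,k}` as a homomorphism -/

section Homomorphism

variable {s : ℝ} {k : ℕ}

lemma integral_radialKernel_pointConvPi (hs : -(1 / 2) ≤ s) (t : Fin k → ℝ)
    (x y : Fin k → ℝ≥0) :
    ∫ z, radialKernel s t z ∂pointConvPi s hs x y = radialKernel s t x * radialKernel s t y := by
  simp only [radialKernel]
  rw [pointConvPi, integral_fintype_prod_eq_prod (fun j (r : ℝ≥0) => evenKernel s (t j * r)),
    ← Finset.prod_mul_distrib]
  refine Finset.prod_congr rfl fun j _ => ?_
  rw [pointConv, integral_map (measurable_sideLength_left _ _).aemeasurable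
    (by have := continuous_evenKernel hs; fun_prop)]
  exact integral_evenKernel_sideLength hs _ _ _

lemma integral_radialKernel_kingmanConv (hs : -(1 / 2) ≤ s) (t : Fin k → ℝ)
    (G₁ G₂ : ProbabilityMeasure (Fin k → ℝ≥0)) :
    ∫ z, radialKernel s t z ∂(kingmanConv s hs G₁ G₂ : Measure (Fin k → ℝ≥0)) =
      (∫ x, radialKernel s t x ∂(G₁ : Measure (Fin k → ℝ≥0))) *
        ∫ y, radialKernel s t y ∂(G₂ : Measure (Fin k → ℝ≥0)) := by
  have hint : Integrable (radialKernel s t)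
      (kingmanConv s hs G₁ G₂ : Measure (Fin k → ℝ≥0)) :=
    .of_bound (measurable_radialKernel hs t).aestronglyMeasurable 1
      (.of_forall (norm_radialKernel_le_one hs t))
  rw [← integral_prod_mul]
  simp only [← integral_radialKernel_pointConvPi hs]
  exact integral_bind (measurable_pointConvPi s hs) hint

lemma kingmanMap_kingmanConv (hs : -(1 / 2) ≤ s) (G₁ G₂ : ProbabilityMeasure (Fin k → ℝ≥0)) :
    kingmanMap s hs (kingmanConv s hs G₁ G₂) =
      ordConv (kingmanMap s hs G₁) (kingmanMap s hs G₂) := by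
  refine kingmanMap_eq_of_charFun hs fun t => ?_
  rw [integral_radialKernel_kingmanConv, Complex.ofReal_mul, ← charFun_kingmanMap hs,
    ← charFun_kingmanMap hs]
  exact charFun_conv t

lemma kingmanMap_pointMass_zero (hs : -(1 / 2) ≤ s) :
    kingmanMap s hs (pointMass (0 : Fin k → ℝ≥0)) = pointMass 0 := by
  refine kingmanMap_eq_of_charFun hs fun t => ?_
  simp only [pointMass, ProbabilityMeasure.coe_mk, integral_dirac, charFun_dirac, radialKernel,
    Pi.zero_apply, NNReal.coe_zero, mul_zero, evenKernel_zero, Finset.prod_const_one,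
    inner_zero_left, Complex.ofReal_zero, zero_mul, Complex.exp_zero, Complex.ofReal_one]

lemma kingmanMap_convexComb (hs : -(1 / 2) ≤ s) {n : ℕ} (w : Fin n → ℝ≥0)
    (hw : ∑ i, w i = 1) (G : Fin n → ProbabilityMeasure (Fin k → ℝ≥0)) :
    kingmanMap s hs (convexComb w hw G) = convexComb w hw fun i => kingmanMap s hs (G i) := by
  refine Subtype.ext ?_
  simp only [kingmanMap, convexComb, ProbabilityMeasure.coe_mk, ← Measure.sum_fintype]
  rw [Measure.bind_sum _ _ (measurable_scaledProduct s hs).aemeasurable]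
  simp only [Measure.bind_smul]

lemma kingmanMap_scale (hs : -(1 / 2) ≤ s) (c : ℝ≥0) (G : ProbabilityMeasure (Fin k → ℝ≥0)) :
    kingmanMap s hs (scale c G) = scale c (kingmanMap s hs G) := by
  refine kingmanMap_eq_of_charFun hs fun t => ?_
  have hkernel (x : Fin k → ℝ≥0) : radialKernel s ((c : ℝ) • t) x = radialKernel s t (c • x) := by
    simp only [radialKernel, PiLp.smul_apply, Pi.smul_apply, smul_eq_mul, NNReal.coe_mul,
      mul_left_comm, mul_assoc]
  calc charFun (scale c (kingmanMap s hs G) : Measure (EuclideanSpace ℝ (Fin k))) t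
      = charFun (kingmanMap s hs G : Measure (EuclideanSpace ℝ (Fin k))) ((c : ℝ) • t) :=
        charFun_map_smul (c : ℝ) t
    _ = ((∫ x, radialKernel s t (c • x) ∂(G : Measure (Fin k → ℝ≥0)) : ℝ) : ℂ) := by
        simp only [charFun_kingmanMap, hkernel]
    _ = _ := congrArg _ (integral_map (measurable_const_smul c).aemeasurable
        (measurable_radialKernel hs t).aestronglyMeasurable).symm

lemma integral_radialKernel_rayleighLaw (hs : -(1 / 2) ≤ s) (t : Fin k → ℝ) :
    ∫ c, radialKernel s t c ∂(rayleighLaw s hs k : Measure (Fin k → ℝ≥0)) =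
      Real.exp (-∑ j, t j ^ 2 / (4 * (s + 1))) := by
  have := isProbabilityMeasure_rayleighMeasure hs
  have hs' : -1 < s := by linarith
  simp only [radialKernel, rayleighLaw, ProbabilityMeasure.coe_mk]
  rw [integral_fintype_prod_eq_prod (fun j (r : ℝ≥0) => evenKernel s (t j * r))]
  simp only [integral_evenKernel_rayleighMeasure hs', ← Real.exp_sum, Finset.sum_neg_distrib]

lemma kingmanMap_rayleighLaw (hs : -(1 / 2) ≤ s) :
    (kingmanMap s hs (rayleighLaw s hs k) : Measure (EuclideanSpace ℝ (Fin k))) =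
      multivariateGaussian 0 ((2 * (s + 1))⁻¹ • (1 : Matrix (Fin k) (Fin k) ℝ)) := by
  have hs1 : 0 < s + 1 := by linarith
  have hquad (t : Fin k → ℝ) : ∑ j, t j ^ 2 / (4 * (s + 1)) =
      t ⬝ᵥ ((2 * (s + 1))⁻¹ • (1 : Matrix (Fin k) (Fin k) ℝ)).mulVec t / 2 := by
    rw [Matrix.smul_mulVec, Matrix.one_mulVec, dotProduct_smul, smul_eq_mul, dotProduct,
      ← Finset.sum_div]
    simp only [← sq]
    field_simp
    norm_num
  refine Measure.ext_of_charFun (funext fun t => ?_)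
  rw [charFun_kingmanMap, integral_radialKernel_rayleighLaw, Complex.ofReal_exp, hquad,
    charFun_multivariateGaussian (Matrix.PosSemidef.one.smul (by positivity)), inner_zero_right]
  push_cast
  rw [zero_mul, zero_sub]

end Homomorphism

/-! ### Injectivity of `F_{s,k}` -/

section Injectivity

open scoped BoundedContinuousFunction

lemma ext_of_forall_mem_submonoid_integral_eq {E : Type*} [TopologicalSpace E] [PolishSpace E]
    [MeasurableSpace E] [BorelSpace E] {μ ν : Measure E} [IsFiniteMeasure μ] [IsFiniteMeasure ν]
    {S : Submonoid (E →ᵇ ℝ)} (hsep : ∀ x y, x ≠ y → ∃ f ∈ S, f x ≠ f y)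
    (h : ∀ f ∈ S, ∫ x, f x ∂μ = ∫ x, f x ∂ν) : μ = ν := by
  let A : StarSubalgebra ℝ (E →ᵇ ℝ) :=
    { Algebra.adjoin ℝ (S : Set (E →ᵇ ℝ)) with
      star_mem' := fun {f} hf => by rwa [show star f = f by ext x; exact star_trivial _] }
  have hA : ∀ f ∈ A, f ∈ Submodule.span ℝ (S : Set (E →ᵇ ℝ)) := fun f hf => by
    rw [← S.closure_eq, ← Algebra.adjoin_eq_span]
    exact hf
  refine ext_of_forall_mem_subalgebra_integral_eq_of_polish (𝕜 := ℝ) (A := A)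
    (fun x y hxy => ?_) fun f hf => ?_
  · obtain ⟨f, hf, hne⟩ := hsep x y hxy
    exact ⟨f, ⟨f.toContinuousMap, ⟨f, Algebra.subset_adjoin hf, rfl⟩, rfl⟩, hne⟩
  · replace hf := hA f hf
    induction hf using Submodule.span_induction with
    | mem f hf => exact h f hf
    | zero => simp
    | add f g _ _ hf hg =>
      simp only [BoundedContinuousFunction.coe_add, Pi.add_apply]
      rw [integral_add (f.integrable μ) (g.integrable μ),
        integral_add (f.integrable ν) (g.integrable ν), hf, hg]
    | smul c f _ hf =>
      simp only [BoundedContinuousFunction.coe_smul, integral_smul, hf]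

variable {s : ℝ} {k : ℕ}

/-- The function `c ↦ exp (-∑ⱼ bⱼ cⱼ²)` on the orthant. These functions separate points, are closed
under multiplication, and have integrals that are averages of radial characteristic functions. -/
def gaussian (b : Fin k → ℝ≥0) : (Fin k → ℝ≥0) →ᵇ ℝ :=
  .ofNormedAddCommGroup (fun c => Real.exp (-∑ j, (b j * c j ^ 2 : ℝ))) (by fun_prop) 1
    fun c => by
      rw [Real.norm_eq_abs, Real.abs_exp]
      exact Real.exp_le_one_iff.2 (neg_nonpos.2 (Finset.sum_nonneg fun j _ => by positivity))

lemma gaussian_apply (b c : Fin k → ℝ≥0) :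
    gaussian b c = Real.exp (-∑ j, (b j * c j ^ 2 : ℝ)) := rfl

lemma gaussian_zero : gaussian (0 : Fin k → ℝ≥0) = 1 := by
  ext c
  simp [gaussian_apply]

lemma gaussian_add (b b' : Fin k → ℝ≥0) : gaussian (b + b') = gaussian b * gaussian b' := by
  ext c
  simp [gaussian_apply, ← Real.exp_add, add_mul, Finset.sum_add_distrib, add_comm]

lemma gaussian_single_ne {x y : Fin k → ℝ≥0} {j : Fin k} (hj : x j ≠ y j) :
    gaussian (Pi.single j 1) x ≠ gaussian (Pi.single j 1) y := by
  have hsingle (c : Fin k → ℝ≥0) : gaussian (Pi.single j 1) c = Real.exp (-(c j : ℝ) ^ 2) := by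
    rw [gaussian_apply, Finset.sum_eq_single j] <;> simp +contextual
  rw [hsingle, hsingle, Ne, Real.exp_eq_exp, neg_inj, sq_eq_sq₀ (by positivity) (by positivity)]
  exact mod_cast hj

lemma ext_of_integral_gaussian {μ ν : Measure (Fin k → ℝ≥0)} [IsFiniteMeasure μ]
    [IsFiniteMeasure ν] (h : ∀ b, ∫ c, gaussian b c ∂μ = ∫ c, gaussian b c ∂ν) : μ = ν := by
  let S : Submonoid ((Fin k → ℝ≥0) →ᵇ ℝ) :=
    { carrier := Set.range gaussian
      one_mem' := ⟨0, gaussian_zero⟩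
      mul_mem' := by
        rintro _ _ ⟨b, rfl⟩ ⟨b', rfl⟩
        exact ⟨b + b', gaussian_add b b'⟩ }
  refine ext_of_forall_mem_submonoid_integral_eq (S := S) (fun x y hxy => ?_) ?_
  · obtain ⟨j, hj⟩ := Function.ne_iff.1 hxy
    exact ⟨gaussian (Pi.single j 1), ⟨_, rfl⟩, gaussian_single_ne hj⟩
  · rintro _ ⟨b, rfl⟩
    exact h b

lemma integral_radialKernel_mul_rayleighLaw (hs : -(1 / 2) ≤ s) (b c : Fin k → ℝ≥0) :
    ∫ r, radialKernel s (fun j => 2 * √((s + 1) * b j) * r j) c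
      ∂(rayleighLaw s hs k : Measure (Fin k → ℝ≥0)) = gaussian b c := by
  have hs1 : 0 < s + 1 := by linarith
  have hswap (r : Fin k → ℝ≥0) : radialKernel s (fun j => 2 * √((s + 1) * b j) * r j) c =
      radialKernel s (fun j => 2 * √((s + 1) * b j) * c j) r :=
    Finset.prod_congr rfl fun j _ => by rw [mul_right_comm]
  simp only [hswap]
  rw [integral_radialKernel_rayleighLaw hs, gaussian_apply]
  congr! 3 with j
  rw [mul_pow, mul_pow, Real.sq_sqrt (by positivity)]
  field_simp
  ring

lemma integral_gaussian (hs : -(1 / 2) ≤ s) (G : ProbabilityMeasure (Fin k → ℝ≥0))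
    (b : Fin k → ℝ≥0) :
    ∫ c, gaussian b c ∂(G : Measure (Fin k → ℝ≥0)) =
      ∫ r, (∫ c, radialKernel s (fun j => 2 * √((s + 1) * b j) * r j) c
        ∂(G : Measure (Fin k → ℝ≥0))) ∂(rayleighLaw s hs k : Measure (Fin k → ℝ≥0)) := by
  have hcont : Continuous fun p : (Fin k → ℝ≥0) × (Fin k → ℝ≥0) =>
      radialKernel s (fun j => 2 * √((s + 1) * b j) * p.1 j) p.2 :=
    (continuous_radialKernel hs).comp
      (f := fun p : (Fin k → ℝ≥0) × (Fin k → ℝ≥0) =>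
        ((fun j => 2 * √((s + 1) * b j) * p.1 j : Fin k → ℝ), p.2)) (by fun_prop)
  rw [integral_integral_swap (.of_bound hcont.aestronglyMeasurable 1
    (.of_forall fun p => norm_radialKernel_le_one hs _ _))]
  simp only [integral_radialKernel_mul_rayleighLaw]

lemma injective_kingmanMap (hs : -(1 / 2) ≤ s) :
    Function.Injective (kingmanMap (k := k) s hs) := by
  intro G₁ G₂ h
  have hkernel (t : Fin k → ℝ) : ∫ c, radialKernel s t c ∂(G₁ : Measure (Fin k → ℝ≥0)) =
      ∫ c, radialKernel s t c ∂(G₂ : Measure (Fin k → ℝ≥0)) := by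
    have h₁ := charFun_kingmanMap hs G₁ (WithLp.toLp 2 t)
    rw [h, charFun_kingmanMap] at h₁
    exact mod_cast h₁.symm
  refine Subtype.ext (ext_of_integral_gaussian (μ := (G₁ : Measure (Fin k → ℝ≥0)))
    (ν := (G₂ : Measure (Fin k → ℝ≥0))) fun b => ?_)
  simp only [integral_gaussian hs, hkernel]

end Injectivity

/-! ### `F_{s,k}` as a closed embedding -/

section ClosedEmbedding

variable {s : ℝ} {k : ℕ}

lemma continuous_kingmanMap (hs : -(1 / 2) ≤ s) : Continuous (kingmanMap (k := k) s hs) := by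
  refine continuous_iff_seqContinuous.2 fun G G₀ hG =>
    ProbabilityMeasure.tendsto_iff_tendsto_charFun.2 fun t => ?_
  let f : BoundedContinuousFunction (Fin k → ℝ≥0) ℝ := .ofNormedAddCommGroup
    (radialKernel s t) ((continuous_radialKernel hs).comp (.prodMk_right _)) 1
    (norm_radialKernel_le_one hs t)
  simp only [Function.comp_apply, charFun_kingmanMap]
  exact (Complex.continuous_ofReal.tendsto _).comp
    (ProbabilityMeasure.tendsto_iff_forall_integral_tendsto.1 hG f)

lemma exists_pos_measure_lt_norm_ne_zero {E : Type*} [NormedAddGroup E] [MeasurableSpace E]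
    {μ : Measure E} (hμ : ¬∀ᵐ x ∂μ, x = 0) : ∃ δ > 0, μ {x | δ < ‖x‖} ≠ 0 := by
  contrapose! hμ
  have hle (n : ℕ) : ∀ᵐ x ∂μ, ‖x‖ ≤ 1 / ((n : ℝ) + 1) := by
    simpa only [ae_iff, not_le] using hμ _ Nat.one_div_pos_of_nat
  filter_upwards [ae_all_iff.2 hle] with x hx
  exact norm_le_zero_iff.1 (ge_of_tendsto' tendsto_one_div_add_atTop_nhds_zero_nat hx)

lemma not_ae_eq_zero_thetaMeasure (hs : -(1 / 2) ≤ s) : ¬∀ᵐ u ∂thetaMeasure s, u = 0 := by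
  intro h
  have hsecond := integral_pow_two_mul_thetaMeasure hs 1
  rw [integral_eq_zero_of_ae (h.mono fun u hu => by simp [hu])] at hsecond
  have := besselCoeff_pos (show -1 < s by linarith) 1
  exact absurd hsecond (by positivity)

lemma thetaMeasure_le_scaledProduct (hs : -(1 / 2) ≤ s) {δ : ℝ} (hδ : 0 < δ) {M : ℝ≥0}
    {c : Fin k → ℝ≥0} {j : Fin k} (hj : M < c j) :
    thetaMeasure s {u | δ < ‖u‖} ≤ scaledProduct s hs c (Metric.closedBall 0 (M * δ))ᶜ := by
  have (i : Fin k) :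
      IsProbabilityMeasure ((thetaLaw s hs : Measure ℝ).map fun u => (c i : ℝ) * u) :=
    Measure.isProbabilityMeasure_map (by fun_prop)
  have hmeas : MeasurableSet {x : ℝ | M * δ < ‖x‖} :=
    measurableSet_lt measurable_const measurable_norm
  have hmarginal := (measurePreserving_eval (fun i => (thetaLaw s hs : Measure ℝ).map
    fun u => (c i : ℝ) * u) j).measure_preimage hmeas.nullMeasurableSet
  rw [Measure.map_apply (by fun_prop) hmeas] at hmarginal
  rw [scaledProduct, Measure.map_apply (by fun_prop)
    Metric.isClosed_closedBall.measurableSet.compl]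
  refine (measure_mono fun u hu => ?_).trans (hmarginal.symm.le.trans (measure_mono fun x hx => ?_))
  · have hj' : (M : ℝ) < c j := hj
    simp only [Set.mem_preimage, Set.mem_ofPred_eq, norm_mul, NNReal.norm_eq] at hu ⊢
    gcongr
  · simp only [Set.mem_preimage, Set.mem_compl_iff, mem_closedBall_zero_iff, not_le]
    exact hx.trans_le (PiLp.norm_apply_le (WithLp.toLp 2 x) j)

lemma mul_measure_compl_Icc_le_kingmanMap (hs : -(1 / 2) ≤ s)
    (G : ProbabilityMeasure (Fin k → ℝ≥0)) {δ : ℝ} (hδ : 0 < δ) (M : ℝ≥0) :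
    thetaMeasure s {u | δ < ‖u‖} * (G : Measure (Fin k → ℝ≥0)) (Set.Icc 0 fun _ => M)ᶜ ≤
      (kingmanMap s hs G : Measure (EuclideanSpace ℝ (Fin k)))
        (Metric.closedBall 0 (M * δ))ᶜ := by
  refine mul_measure_le_bind (measurable_scaledProduct s hs)
    Metric.isClosed_closedBall.measurableSet.compl fun c hc => ?_
  obtain ⟨j, hj⟩ : ∃ j, M < c j := by simpa [Pi.le_def] using hc
  exact thetaMeasure_le_scaledProduct hs hδ hj

lemma isTightMeasureSet_preimage_kingmanMap (hs : -(1 / 2) ≤ s)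
    {𝒦 : Set (ProbabilityMeasure (EuclideanSpace ℝ (Fin k)))}
    (h𝒦 : IsTightMeasureSet {(P : Measure (EuclideanSpace ℝ (Fin k))) | P ∈ 𝒦}) :
    IsTightMeasureSet {(G : Measure (Fin k → ℝ≥0)) | G ∈ kingmanMap s hs ⁻¹' 𝒦} := by
  rw [isTightMeasureSet_iff_exists_isCompact_measure_compl_le] at h𝒦 ⊢
  intro ε hε
  have := isProbabilityMeasure_thetaMeasure hs
  obtain ⟨δ, hδ, hq0⟩ := exists_pos_measure_lt_norm_ne_zero (not_ae_eq_zero_thetaMeasure hs)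
  set q := thetaMeasure s {u | δ < ‖u‖}
  obtain ⟨C, hC, hCle⟩ := h𝒦 (ε * q) (pos_iff_ne_zero.2 (mul_ne_zero hε.ne' hq0))
  obtain ⟨R, hR⟩ := hC.isBounded.subset_closedBall 0
  set M := Real.toNNReal (R / δ)
  have hRM : R ≤ M * δ := (div_le_iff₀ hδ).1 (Real.le_coe_toNNReal _)
  refine ⟨Set.Icc 0 fun _ => M, isCompact_Icc, ?_⟩
  rintro _ ⟨G, hG, rfl⟩
  refine (ENNReal.mul_le_mul_iff_right hq0 (measure_ne_top _ _)).1 ?_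
  calc q * (G : Measure (Fin k → ℝ≥0)) (Set.Icc 0 fun _ => M)ᶜ
      ≤ (kingmanMap s hs G : Measure (EuclideanSpace ℝ (Fin k)))
          (Metric.closedBall 0 (M * δ))ᶜ := mul_measure_compl_Icc_le_kingmanMap hs G hδ M
    _ ≤ (kingmanMap s hs G : Measure (EuclideanSpace ℝ (Fin k))) Cᶜ :=
        measure_mono (Set.compl_subset_compl.2 (hR.trans (Metric.closedBall_subset_closedBall hRM)))
    _ ≤ ε * q := hCle _ ⟨_, hG, rfl⟩
    _ = q * ε := mul_comm _ _

lemma isCompact_preimage_kingmanMap (hs : -(1 / 2) ≤ s)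
    {𝒦 : Set (ProbabilityMeasure (EuclideanSpace ℝ (Fin k)))} (h𝒦 : IsCompact 𝒦) :
    IsCompact (kingmanMap s hs ⁻¹' 𝒦) := by
  rw [← (h𝒦.isClosed.preimage (continuous_kingmanMap hs)).closure_eq]
  exact isCompact_closure_of_isTightMeasureSet (isTightMeasureSet_preimage_kingmanMap hs
    (isTightMeasureSet_of_isCompact_closure (h𝒦.isClosed.closure_eq.symm ▸ h𝒦)))

lemma isClosedEmbedding_kingmanMap (hs : -(1 / 2) ≤ s) :
    IsClosedEmbedding (kingmanMap (k := k) s hs) :=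
  .of_continuous_injective_isClosedMap (continuous_kingmanMap hs) (injective_kingmanMap hs)
    (isProperMap_iff_isCompact_preimage.2 ⟨continuous_kingmanMap hs,
      fun _ h𝒦 => isCompact_preimage_kingmanMap hs h𝒦⟩).isClosedMap

end ClosedEmbedding

end

end Kingman

theorem mainTheorem4 (s : ℝ) (hs : -(1 / 2) ≤ s) (k : ℕ) (hk : 1 ≤ k) :
    -- `F_s` has characteristic function `Λ_s`
    (∀ t : ℝ, 0 ≤ t → charFun (Kingman.thetaLaw s hs : Measure ℝ) t = (Kingman.kernel s t : ℂ)) ∧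
    -- the image of `F_{s,k}` is weakly closed
    IsClosed (Set.range (Kingman.kingmanMap (k := k) s hs)) ∧
    -- the image of `F_{s,k}` is closed under ordinary convolution
    (∀ P ∈ Set.range (Kingman.kingmanMap (k := k) s hs),
      ∀ Q ∈ Set.range (Kingman.kingmanMap (k := k) s hs),
        Kingman.ordConv P Q ∈ Set.range (Kingman.kingmanMap (k := k) s hs)) ∧
    -- the radial characteristic function of `G` is the Fourier transform of `F_{s,k}(G)`
    (∀ (G : ProbabilityMeasure (Fin k → ℝ≥0)) (t : Fin k → ℝ≥0),
      (Kingman.radialCharFun s G t : ℂ) =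
        charFun (Kingman.kingmanMap s hs G : Measure (EuclideanSpace ℝ (Fin k)))
          (WithLp.toLp 2 fun j => (t j : ℝ))) ∧
    -- `F_{s,k}` is a homomorphism of convolution algebras
    (∀ G₁ G₂ : ProbabilityMeasure (Fin k → ℝ≥0),
      Kingman.kingmanMap s hs (Kingman.kingmanConv s hs G₁ G₂) =
        Kingman.ordConv (Kingman.kingmanMap s hs G₁) (Kingman.kingmanMap s hs G₂)) ∧
    Kingman.kingmanMap s hs (Kingman.pointMass (0 : Fin k → ℝ≥0)) = Kingman.pointMass 0 ∧
    -- `F_{s,k}` commutes with convex combinations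
    (∀ (n : ℕ) (w : Fin n → ℝ≥0) (hw : ∑ i, w i = 1)
      (G : Fin n → ProbabilityMeasure (Fin k → ℝ≥0)),
      Kingman.kingmanMap s hs (Kingman.convexComb w hw G) =
        Kingman.convexComb w hw fun i => Kingman.kingmanMap s hs (G i)) ∧
    -- `F_{s,k}` commutes with scale changes
    (∀ c : ℝ≥0, 0 < c → ∀ G : ProbabilityMeasure (Fin k → ℝ≥0),
      Kingman.kingmanMap s hs (Kingman.scale c G) =
        Kingman.scale c (Kingman.kingmanMap s hs G)) ∧
    -- `F_{s,k}` sends the Rayleigh law to the centered normal law of covariance `(2(s+1))⁻¹ I`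
    (Kingman.kingmanMap s hs (Kingman.rayleighLaw s hs k) :
        Measure (EuclideanSpace ℝ (Fin k))) =
      multivariateGaussian 0 ((2 * (s + 1))⁻¹ • (1 : Matrix (Fin k) (Fin k) ℝ)) ∧
    -- `F_{s,k}` is a homeomorphism onto its image
    IsEmbedding (Kingman.kingmanMap (k := k) s hs) := by
  have hemb := Kingman.isClosedEmbedding_kingmanMap (k := k) hs
  refine ⟨fun t ht => ?_, hemb.isClosed_range, ?_, Kingman.radialCharFun_eq_charFun hs,
    Kingman.kingmanMap_kingmanConv hs, Kingman.kingmanMap_pointMass_zero hs,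
    fun n w hw G => Kingman.kingmanMap_convexComb hs w hw G,
    fun c _ G => Kingman.kingmanMap_scale hs c G, Kingman.kingmanMap_rayleighLaw hs,
    hemb.isEmbedding⟩
  · exact Kingman.evenKernel_of_nonneg s ht ▸ Kingman.charFun_thetaMeasure hs t
  · rintro _ ⟨G₁, rfl⟩ _ ⟨G₂, rfl⟩
    exact ⟨Kingman.kingmanConv s hs G₁ G₂, Kingman.kingmanMap_kingmanConv hs G₁ G₂⟩
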